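/- Let $K$ be a field. A $K$-variety is a separated $K$-scheme of finite type. The étale open topology $\mathscr{E}_K$ equips the set $V(K)$ of $K$-points of each $K$-variety $V$ with the topology having as a basis the sets $f(W(K))$, where $f\colon W\to V$ is an étale morphism of $K$-varieties. A field topology on $K$ is a Hausdorff, non-discrete topology for which the field operations (including inversion on $K^\times$) are continuous; it is locally bounded if $0$ has a neighbourhood $B$ such that for every neighbourhood $U$ of $0$ there is a neighbourhood $U'$ of $0$ with $U'\cdot B\subseteq U$. A field topology on $K$ induces a topology on $V(K)$ for every $K$-variety $V$ (for $V$ closed in $\mathbb{A}^n$ the subspace topology from $K^n$, and in general by gluing along affine opens), and we say that it induces $\mathscr{E}_K$ if this topology agrees with the étale open topology on $V(K)$ for every $K$-variety $V$. For a local domain $R\subsetneq K$ with fraction field $K$, the $R$-adic topology on $K$ is the field topology with basis $\{aR+b : a\in K^\times,\ b\in K\}$. **Theorem.** The étale open topology $\mathscr{E}_K$ is induced by a locally bounded field topology on $K$ if and only if there exist an elementary extension $K^*\succ K$ (in the language of rings) and a henselian local domain $R\subsetneq K^*$ with fraction field $K^*$ such that the $R$-adic topology on $K^*$ induces $\mathscr{E}_{K^*}$.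 -/

import Mathlib

open CategoryTheory AlgebraicGeometry Topology

universe u

namespace EtaleOpen

section Varieties

variable {K : Type u} [Field K]

/-- A `K`-variety is a separated `K`-scheme of finite type (not necessarily irreducible or
reduced). -/
class IsVariety (X : Over (Spec (CommRingCat.of K))) : Prop where
  separated : IsSeparated X.hom
  locallyOfFiniteType : LocallyOfFiniteType X.hom
  quasiCompact : QuasiCompact X.hom

/-- The set `X(K)` of `K`-points of a `K`-scheme `X`: the morphisms `Spec K ⟶ X` over `Spec K`. -/
abbrev Points (X : Over (Spec (CommRingCat.of K))) : Type u :=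
  Over.mk (𝟙 (Spec (CommRingCat.of K))) ⟶ X

/-- The map `Y(K) → X(K)` induced by a morphism `Y ⟶ X` of `K`-schemes. -/
noncomputable def mapPoints {Y X : Over (Spec (CommRingCat.of K))} (f : Y ⟶ X) (y : Points Y) : Points X :=
  y ≫ f

/-- An étale image in `X(K)`: a set `f(Y(K))` for an étale morphism `f : Y ⟶ X` of
`K`-varieties. -/
def IsEtaleImage (X : Over (Spec (CommRingCat.of K))) (U : Set (Points X)) : Prop :=
  ∃ (Y : Over (Spec (CommRingCat.of K))) (f : Y ⟶ X),
    IsVariety Y ∧ Etale f.left ∧ U = Set.range (mapPoints f)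

/-- The étale open topology on `X(K)`, generated by the étale images. -/
@[reducible] noncomputable def etaleOpenTopology (X : Over (Spec (CommRingCat.of K))) : TopologicalSpace (Points X) :=
  TopologicalSpace.generateFrom {U | IsEtaleImage X U}

/-- For an open subscheme `W` of `X`, the set `W(K) ⊆ X(K)` of `K`-points of `X` that factor
through `W`. -/
def pointsIn (X : Over (Spec (CommRingCat.of K))) (W : X.left.Opens) : Set (Points X) :=
  {p | ⊤ ≤ p.left ⁻¹ᵁ W}

/-- The value `f(p) ∈ K` of a regular function `f` on `W` at a `K`-point `p ∈ W(K)`. -/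
noncomputable def evalAt (X : Over (Spec (CommRingCat.of K))) (W : X.left.Opens)
    (f : Γ(X.left, W)) (p : pointsIn X W) : K :=
  (Scheme.ΓSpecIso (CommRingCat.of K)).hom.hom ((p.1.left.appLE W ⊤ p.2).hom f)

/-- For a topology `τ` on `K` and an affine open `W` of `X`, the `τ`-topology on `W(K)`: the
coarsest topology making all regular functions `W(K) → K` continuous. If `K` is a topological ring
this is the subspace topology from `Kⁿ` for any closed immersion of `W` into affine `n`-space. -/
@[reducible] noncomputable def affineTopology (τ : TopologicalSpace K) (X : Over (Spec (CommRingCat.of K)))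
    (W : X.left.Opens) : TopologicalSpace (pointsIn X W) :=
  ⨅ f : Γ(X.left, W), τ.induced (evalAt X W f)

/-- The `τ`-topology on `X(K)`, glued from the `τ`-topologies on the sets `W(K)`, `W` affine open:
a subset is open if and only if its intersection with each such `W(K)` is open in `W(K)`. -/
@[reducible] noncomputable def pointsTopology (τ : TopologicalSpace K) (X : Over (Spec (CommRingCat.of K))) :
    TopologicalSpace (Points X) :=
  ⨆ W : X.left.affineOpens, (affineTopology τ X W.1).coinduced Subtype.val

/-- The topology `τ` on `K` induces the étale open topology over `K`: both agree on `X(K)` for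
every `K`-variety `X`. -/
def InducesEtaleOpen (τ : TopologicalSpace K) : Prop :=
  ∀ X : Over (Spec (CommRingCat.of K)), IsVariety X → pointsTopology τ X = etaleOpenTopology X

end Varieties

section FieldTopologies

variable {K : Type u} [Field K]

/-- A field topology: the field operations are continuous, and the topology is Hausdorff and not
discrete. -/
structure IsFieldTopology (τ : TopologicalSpace K) : Prop where
  isTopologicalDivisionRing : @IsTopologicalDivisionRing K _ τ
  hausdorff : @T2Space K τ
  not_discrete : ¬ @DiscreteTopology K τ

/-- `B` is bounded: for every neighbourhood `U` of `0` there is a neighbourhood `V` of `0` with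
`V · B ⊆ U`. -/
def IsBddFor (τ : TopologicalSpace K) (B : Set K) : Prop :=
  ∀ U ∈ @nhds K τ 0, ∃ V ∈ @nhds K τ 0, ∀ v ∈ V, ∀ b ∈ B, v * b ∈ U

/-- The topology is locally bounded: there is a bounded neighbourhood of `0`. -/
def IsLocallyBdd (τ : TopologicalSpace K) : Prop :=
  ∃ B ∈ @nhds K τ 0, IsBddFor τ B

/-- The `R`-adic topology on `K`, generated by the sets `a R + b`, `a ∈ Kˣ`, `b ∈ K`. -/
@[reducible] def adicTopology (R : Subring K) : TopologicalSpace K :=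
  TopologicalSpace.generateFrom
    {U | ∃ a b : K, a ≠ 0 ∧ U = (fun r : K => a * r + b) '' (R : Set K)}

end FieldTopologies

/-- The ring homomorphism `φ : K → L` of fields makes `L` an elementary extension of `K` in the
language of rings. -/
def IsElementaryExtension {K L : Type u} [Field K] [Field L] (φ : K →+* L) : Prop :=
  letI := FirstOrder.Ring.compatibleRingOfRing K
  letI := FirstOrder.Ring.compatibleRingOfRing L
  ∃ e : FirstOrder.Language.ElementaryEmbedding FirstOrder.Language.ring K L, ∀ x, e x = φ x

end EtaleOpen

/-! Both directions rest on one criterion, `inducesEtaleOpen_of_lineSet`. A Hausdorff topology with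
continuous field operations induces the étale open topology once (a) it is henselian in the sense of
`IsHenselianFor`, so that simple roots vary continuously and étale images are open, and (b) some
étale image in the affine line contains 0 and has a nonzero multiple inside every neighbourhood of
0, so that its affine rescalings are arbitrarily small étale neighbourhoods. Étale morphisms are
locally standard étale, so étale images may be replaced by the concrete sets `P = 0`, `P' Q ≠ 0`.

From the topology to the ring: take the ultrapower of `K` along an ultrafilter on `K` refining the
punctured neighbourhoods of 0, and let `R` be the germs that have a limit in `K`. It is local, its
maximal ideal being the germs with limit 0. The given topology is henselian because étale morphisms
are open on `K`-points, and `R` inherits this. The germ of the identity is an infinitesimal that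
carries bounded germs into `R`; hence local boundedness makes the ultrapower the fraction field of
`R`, and an étale image inside a bounded neighbourhood transfers coordinatewise to one satisfying
(b).

From the ring to the topology: an étale image `U ⊆ R` around 0 contains a multiple of `R`, so its
multiples form a neighbourhood basis of 0. The parameters of `U` lie in the extension, but it is a
first-order sentence that some member of the family is basic and can be scaled into every member
containing 0. So `K` has parameters `p` with this property. Back in the extension, minimality makes
the set of `p` commensurable with `R`. Henselianity, one formula per degree, therefore holds for `p`
there and descends to `K`, where the multiples of the set of `p` define the required topology. -/

namespace EtaleOpen

open Filter Polynomial FirstOrder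

/-! ### Locally bounded field topologies from a single set -/

section BasicSets

variable {F : Type u} [Field F]

/-- The sets `U` such that the multiples `a U`, `a ≠ 0`, form a basis of neighbourhoods of `0` for
a locally bounded field topology. Every clause is first order in `U`. -/
structure IsBasic (U : Set F) : Prop where
  zero_mem : 0 ∈ U
  exists_ne : ∃ u ∈ U, u ≠ 0
  sep : ∃ a : F, a ≠ 0 ∧ ∀ u ∈ U, a * u ≠ 1
  neg : ∃ a : F, a ≠ 0 ∧ ∀ u ∈ U, -(a * u) ∈ U
  add : ∃ a : F, a ≠ 0 ∧ ∀ u ∈ U, ∀ v ∈ U, a * u + a * v ∈ U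
  mul : ∃ a : F, a ≠ 0 ∧ ∀ u ∈ U, ∀ v ∈ U, a * u * v ∈ U
  inv : ∀ d : F, d ≠ 0 → ∃ a : F, a ≠ 0 ∧ ∀ u ∈ U, ∃ v ∈ U, (1 + a * u) * (1 + d * v) = 1
  inter : ∀ b : F, b ≠ 0 → ∃ a : F, a ≠ 0 ∧ ∀ u ∈ U, a * u ∈ U ∧ ∃ v ∈ U, a * u = b * v

/-- The multiple `a U`. -/
def scale (a : F) (U : Set F) : Set F := (fun u => a * u) '' U

namespace IsBasic

variable {U : Set F} (hU : IsBasic U)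

include hU in
theorem exists_scale_subset_inter {b c : F} (hb : b ≠ 0) (hc : c ≠ 0) :
    ∃ a : F, a ≠ 0 ∧ scale a U ⊆ scale b U ∩ scale c U := by
  obtain ⟨a, ha, h⟩ := hU.inter (c / b) (div_ne_zero hc hb)
  refine ⟨b * a, mul_ne_zero hb ha, ?_⟩
  rintro _ ⟨u, hu, rfl⟩
  obtain ⟨h1, v, hv, h2⟩ := h u hu
  refine ⟨⟨a * u, h1, by simp only; ring⟩, v, hv, ?_⟩
  simp only [mul_assoc, h2]
  field_simp

/-- The ring filter basis of the multiples of a basic set. -/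
@[reducible] def ringFilterBasis : RingFilterBasis F where
  sets := {V | ∃ a : F, a ≠ 0 ∧ V = scale a U}
  nonempty := ⟨scale 1 U, 1, one_ne_zero, rfl⟩
  inter_sets := by
    rintro _ _ ⟨a, ha, rfl⟩ ⟨b, hb, rfl⟩
    obtain ⟨c, hc, h⟩ := hU.exists_scale_subset_inter ha hb
    exact ⟨_, ⟨c, hc, rfl⟩, h⟩
  zero' := by
    rintro _ ⟨a, ha, rfl⟩
    exact ⟨0, hU.zero_mem, mul_zero a⟩
  add' := by
    rintro _ ⟨a, ha, rfl⟩
    obtain ⟨b, hb, h⟩ := hU.add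
    refine ⟨_, ⟨a * b, mul_ne_zero ha hb, rfl⟩, ?_⟩
    rintro _ ⟨_, ⟨u, hu, rfl⟩, _, ⟨v, hv, rfl⟩, rfl⟩
    exact ⟨_, h u hu v hv, by simp only; ring⟩
  neg' := by
    rintro _ ⟨a, ha, rfl⟩
    obtain ⟨b, hb, h⟩ := hU.neg
    refine ⟨_, ⟨a * b, mul_ne_zero ha hb, rfl⟩, ?_⟩
    rintro _ ⟨u, hu, rfl⟩
    exact ⟨_, h u hu, by simp only; ring⟩
  conj' := by
    rintro x _ ⟨a, ha, rfl⟩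
    exact ⟨_, ⟨a, ha, rfl⟩, fun y hy => by simpa using hy⟩
  mul' := by
    rintro _ ⟨a, ha, rfl⟩
    obtain ⟨b, hb, h⟩ := hU.mul
    obtain ⟨c, hc, h'⟩ := hU.inter (a * b) (mul_ne_zero ha hb)
    refine ⟨_, ⟨c, hc, rfl⟩, ?_⟩
    rintro _ ⟨_, ⟨u, hu, rfl⟩, _, ⟨v, hv, rfl⟩, rfl⟩
    obtain ⟨-, w, hw, h1⟩ := h' u hu
    refine ⟨_, h w hw _ (h' v hv).1, ?_⟩
    simp only [h1]; ring
  mul_left' := by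
    rintro x _ ⟨a, ha, rfl⟩
    by_cases hx : x = 0
    · refine ⟨_, ⟨a, ha, rfl⟩, fun y _ => ⟨0, hU.zero_mem, by simp [hx]⟩⟩
    · refine ⟨_, ⟨x⁻¹ * a, mul_ne_zero (inv_ne_zero hx) ha, rfl⟩, ?_⟩
      rintro _ ⟨u, hu, rfl⟩
      exact ⟨u, hu, by field_simp⟩
  mul_right' := by
    rintro x _ ⟨a, ha, rfl⟩
    by_cases hx : x = 0
    · refine ⟨_, ⟨a, ha, rfl⟩, fun y _ => ⟨0, hU.zero_mem, by simp [hx]⟩⟩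
    · refine ⟨_, ⟨x⁻¹ * a, mul_ne_zero (inv_ne_zero hx) ha, rfl⟩, ?_⟩
      rintro _ ⟨u, hu, rfl⟩
      exact ⟨u, hu, by field_simp⟩

/-- The field topology defined by a basic set. -/
@[reducible] def topology : TopologicalSpace F := hU.ringFilterBasis.topology

theorem mem_nhds_zero_iff {V : Set F} :
    V ∈ @nhds F hU.topology 0 ↔ ∃ a : F, a ≠ 0 ∧ ∀ u ∈ U, a * u ∈ V := by
  rw [(hU.ringFilterBasis.toAddGroupFilterBasis.nhds_zero_hasBasis).mem_iff]
  constructor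
  · rintro ⟨_, ⟨a, ha, rfl⟩, h⟩
    exact ⟨a, ha, fun u hu => h ⟨u, hu, rfl⟩⟩
  · rintro ⟨a, ha, h⟩
    refine ⟨_, ⟨a, ha, rfl⟩, ?_⟩
    rintro _ ⟨u, hu, rfl⟩
    exact h u hu

theorem isTopologicalDivisionRing : @IsTopologicalDivisionRing F _ hU.topology := by
  let := hU.topology
  have : IsTopologicalRing F := hU.ringFilterBasis.isTopologicalRing
  -- Continuity of inversion at 1 suffices, since multiplication by `x⁻¹` carries a neighbourhood of
  -- `x` to one of 1.
  have key : Tendsto (fun t : F => t⁻¹) (𝓝 1) (𝓝 1) := by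
    have h1 : Tendsto (fun t : F => (1 + t)⁻¹ - 1) (𝓝 0) (𝓝 0) := by
      intro V hV
      obtain ⟨d, hd, h⟩ := hU.mem_nhds_zero_iff.1 hV
      obtain ⟨a, ha, h'⟩ := hU.inv d hd
      refine hU.mem_nhds_zero_iff.2 ⟨a, ha, fun u hu => ?_⟩
      obtain ⟨v, hv, h2⟩ := h' u hu
      have : (1 + a * u)⁻¹ - 1 = d * v := by
        rw [inv_eq_of_mul_eq_one_right h2]; ring
      simp only [Set.mem_preimage, this]
      exact h v hv
    have h2 : Tendsto (fun t : F => t - 1) (𝓝 1) (𝓝 0) := by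
      have : Continuous fun t : F => t - 1 := by fun_prop
      simpa using this.tendsto 1
    have h3 := ((h1.comp h2).add_const 1)
    simpa [Function.comp_def] using h3
  refine { continuousAt_inv₀ := fun x hx => ?_ }
  have h4 : Tendsto (fun t : F => x⁻¹ * t) (𝓝 x) (𝓝 1) := by
    have : Continuous fun t : F => x⁻¹ * t := by fun_prop
    simpa [hx] using this.tendsto x
  have h5 := (key.comp h4).const_mul x⁻¹
  have h6 : (fun t : F => x⁻¹ * (x⁻¹ * t)⁻¹) = fun t => t⁻¹ := by
    ext t; rw [mul_inv, inv_inv, inv_mul_cancel_left₀ hx]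
  simpa [Function.comp_def, ContinuousAt, h6, -mul_inv_rev] using h5

theorem isFieldTopology : IsFieldTopology hU.topology := by
  let := hU.topology
  have := hU.isTopologicalDivisionRing
  refine ⟨hU.isTopologicalDivisionRing, ?_, ?_⟩
  · rw [hU.ringFilterBasis.toAddGroupFilterBasis.t2Space_iff_sInter_subset rfl]
    intro x hx
    by_contra hx0
    rw [Set.mem_singleton_iff] at hx0
    obtain ⟨a, ha, h⟩ := hU.sep
    obtain ⟨u, hu, h'⟩ := hx (scale (x * a) U) ⟨_, mul_ne_zero hx0 ha, rfl⟩
    refine h u hu (mul_left_cancel₀ hx0 ?_)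
    simpa [mul_assoc] using h'
  · intro hd
    obtain ⟨a, ha, h⟩ := hU.mem_nhds_zero_iff.1 (show {0} ∈ 𝓝 (0 : F) by simp)
    obtain ⟨u, hu, hne⟩ := hU.exists_ne
    exact mul_ne_zero ha hne (h u hu)

theorem isBddFor (b : F) : IsBddFor hU.topology (scale b U) := by
  intro V hV
  obtain ⟨c, hc, h⟩ := hU.mem_nhds_zero_iff.1 hV
  obtain ⟨a, ha, h'⟩ := hU.mul
  by_cases hb : b = 0
  · refine ⟨Set.univ, univ_mem, ?_⟩
    rintro v - _ ⟨u, hu, rfl⟩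
    simpa [hb] using h 0 hU.zero_mem
  refine ⟨scale (c * a * b⁻¹) U, hU.mem_nhds_zero_iff.2
    ⟨_, mul_ne_zero (mul_ne_zero hc ha) (inv_ne_zero hb), fun u hu => ⟨u, hu, rfl⟩⟩, ?_⟩
  rintro _ ⟨u, hu, rfl⟩ _ ⟨v, hv, rfl⟩
  have : (fun u => c * a * b⁻¹ * u) u * (fun u => b * u) v = c * (a * u * v) := by
    simp only; field_simp
  rw [this]
  exact h _ (h' u hu v hv)

theorem scale_mem_nhds {a : F} (ha : a ≠ 0) : scale a U ∈ @nhds F hU.topology 0 :=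
  hU.mem_nhds_zero_iff.2 ⟨a, ha, fun u hu => ⟨u, hu, rfl⟩⟩

theorem isLocallyBdd : IsLocallyBdd hU.topology :=
  ⟨scale 1 U, hU.scale_mem_nhds one_ne_zero, hU.isBddFor 1⟩

end IsBasic

end BasicSets

/-! ### The topology of a local subring -/

section Adic

variable {L : Type u} [Field L] (R : Subring L)

theorem exists_mul_mem [IsFractionRing R L] (x : L) : ∃ c ∈ R, c ≠ 0 ∧ c * x ∈ R := by
  obtain ⟨⟨r, s⟩, h⟩ := IsLocalization.surj (nonZeroDivisors R) x
  refine ⟨s.1, s.1.2, fun h0 => nonZeroDivisors.coe_ne_zero s (Subtype.ext h0), ?_⟩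
  rw [mul_comm]
  have : x * (s.1 : L) = r := h
  rw [this]
  exact r.2

theorem exists_ne_zero_not_isUnit (hR : R ≠ ⊤) [IsFractionRing R L] :
    ∃ m : R, m ≠ 0 ∧ ¬ IsUnit m := by
  by_contra! H
  refine hR (eq_top_iff.2 fun x _ => ?_)
  obtain ⟨c, hc, hc0, hcx⟩ := exists_mul_mem R x
  obtain ⟨d, hd⟩ := isUnit_iff_exists_inv.1 (H ⟨c, hc⟩ fun h => hc0 congr(($h : R).1))
  have h1 : c * (d : L) = 1 := congr(($hd : R).1)
  have : x = d * (c * x) := by linear_combination -x * h1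
  rw [this]
  exact R.mul_mem d.2 hcx

/-- A set squeezed between a local subring with the right fraction field and a nonzero multiple
of it is basic. -/
theorem isBasic_of_local (hR : R ≠ ⊤) [IsLocalRing R] [IsFractionRing R L] {U : Set L}
    {a : L} (ha : a ≠ 0) (haU : ∀ r ∈ R, a * r ∈ U) {b : L} (hb : b ≠ 0)
    (hUR : ∀ u ∈ U, b * u ∈ R) : IsBasic U := by
  obtain ⟨m, hm0, hm⟩ := exists_ne_zero_not_isUnit R hR
  have hm0' : (m : L) ≠ 0 := fun h => hm0 (Subtype.ext h)
  -- As `m` is a nonunit of a local ring, `1 + m r` is a unit, and its inverse again has the form `1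
  -- + m s`.
  have unit : ∀ r ∈ R, ∃ s ∈ R, (1 + m * r) * (1 + m * s) = 1 := by
    intro r hr
    have h1 : IsUnit (1 + m * ⟨r, hr⟩ : R) := by
      have : ¬ IsUnit (-(m * ⟨r, hr⟩) : R) := fun h =>
        hm (isUnit_of_mul_isUnit_left (IsUnit.neg_iff _ |>.1 h))
      rcases IsLocalRing.isUnit_or_isUnit_one_sub_self (-(m * ⟨r, hr⟩) : R) with h | h
      · exact absurd h this
      · simpa using h
    obtain ⟨d, hd⟩ := isUnit_iff_exists_inv.1 h1
    have h2 : (1 + m * r) * (d : L) = 1 := congr(($hd : R).1)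
    refine ⟨-(r * d), R.neg_mem (R.mul_mem hr d.2), ?_⟩
    have : (1 : L) + m * -(r * d) = d := by linear_combination -h2
    rw [this, h2]
  have hab : a * b ≠ 0 := mul_ne_zero ha hb
  -- Scaling by `b` moves `U` into `R`, where ring operations are available, and scaling by `a`
  -- returns to `U`; hence the factor `a * b`.
  refine ⟨?_, ⟨a, ?_, ha⟩, ⟨m * b, mul_ne_zero hm0' hb, ?_⟩, ⟨a * b, hab, ?_⟩, ⟨a * b, hab, ?_⟩,
    ⟨a * b * b, mul_ne_zero hab hb, ?_⟩, ?_, ?_⟩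
  · simpa using haU 0 R.zero_mem
  · simpa using haU 1 R.one_mem
  · intro u hu h
    refine hm (isUnit_iff_exists_inv.2 ⟨⟨b * u, hUR u hu⟩, Subtype.ext ?_⟩)
    simpa [mul_assoc] using h
  · intro u hu
    have := haU _ (R.neg_mem (hUR u hu))
    convert this using 1; ring
  · intro u hu v hv
    have := haU _ (R.add_mem (hUR u hu) (hUR v hv))
    convert this using 1; ring
  · intro u hu v hv
    have := haU _ (R.mul_mem (hUR u hu) (hUR v hv))
    convert this using 1; ring
  · intro d hd
    -- The denominator `c` keeps the correction term of the inverse in `R` after division by `d a`.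
    obtain ⟨c, hc, hc0, hcd⟩ := exists_mul_mem R ((d * a)⁻¹)
    refine ⟨m * (c * b), mul_ne_zero hm0' (mul_ne_zero hc0 hb), fun u hu => ?_⟩
    have hr : c * (b * u) ∈ R := R.mul_mem hc (hUR u hu)
    obtain ⟨s, hs, h⟩ := unit _ hr
    have h1 : (1 + m * (c * (b * u))) ≠ 0 := left_ne_zero_of_mul_eq_one h
    refine ⟨a * (-(m * (c * (d * a)⁻¹) * (b * u) * (1 + m * s))), haU _ ?_, ?_⟩
    · exact R.neg_mem (R.mul_mem (R.mul_mem (R.mul_mem m.2 hcd) (hUR u hu))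
        (R.add_mem R.one_mem (R.mul_mem m.2 hs)))
    · have hda : d * a * (d * a)⁻¹ = 1 := mul_inv_cancel₀ (mul_ne_zero hd ha)
      generalize (d * a)⁻¹ = e at hda
      linear_combination (-(1 + m * (c * b) * u) * (m * c * b * u * (1 + m * s))) * hda
        - m * c * b * u * h
  · intro d hd
    obtain ⟨c, hc, hc0, hcd⟩ := exists_mul_mem R (d⁻¹)
    refine ⟨a * c * b, mul_ne_zero (mul_ne_zero ha hc0) hb, fun u hu => ⟨?_, ?_⟩⟩
    · have := haU _ (R.mul_mem hc (hUR u hu))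
      convert this using 1; ring
    · refine ⟨a * (c * d⁻¹ * (b * u)), haU _ (R.mul_mem hcd (hUR u hu)), ?_⟩
      field_simp

theorem isBasic_subring (hR : R ≠ ⊤) [IsLocalRing R] [IsFractionRing R L] :
    IsBasic (R : Set L) :=
  isBasic_of_local R hR one_ne_zero (by simp) one_ne_zero (by simp)

/-- Since `R` is closed under addition, `a R + b` is a neighbourhood of each of its points, so the
generating sets are open in the group topology; conversely they contain a basic neighbourhood around
every point of an open set. -/
theorem adicTopology_eq (hR : R ≠ ⊤) [IsLocalRing R] [IsFractionRing R L] :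
    adicTopology R = (isBasic_subring R hR).topology := by
  have hB := isBasic_subring R hR
  let := hB.topology
  have := hB.isTopologicalDivisionRing
  have hnhds : ∀ (x : L) (S : Set L), S ∈ 𝓝 x ↔ ∃ a : L, a ≠ 0 ∧ ∀ r ∈ R, x + a * r ∈ S := by
    intro x S
    rw [← map_add_left_nhds_zero, mem_map, hB.mem_nhds_zero_iff]
    rfl
  apply le_antisymm
  · rw [TopologicalSpace.le_def]
    intro S hS
    have hS' : ∀ x ∈ S, ∃ a : L, a ≠ 0 ∧ ∀ r ∈ R, x + a * r ∈ S := fun x hx =>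
      (hnhds x S).1 (hS.mem_nhds hx)
    choose! a ha hS' using hS'
    have : S = ⋃ x ∈ S, (fun r : L => a x * r + x) '' (R : Set L) := by
      apply subset_antisymm
      · intro x hx
        simp only [Set.mem_iUnion]
        exact ⟨x, hx, 0, R.zero_mem, by simp⟩
      · simp only [Set.iUnion_subset_iff]
        rintro x hx _ ⟨r, hr, rfl⟩
        simpa [add_comm] using hS' x hx r hr
    rw [this]
    let := adicTopology R
    exact isOpen_biUnion fun x hx => TopologicalSpace.isOpen_generateFrom_of_mem
      ⟨a x, x, ha x hx, rfl⟩
  · refine le_generateFrom ?_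
    rintro _ ⟨a, b, ha, rfl⟩
    rw [isOpen_iff_mem_nhds]
    rintro _ ⟨r, hr, rfl⟩
    refine (hnhds _ _).2 ⟨a, ha, fun s hs => ⟨r + s, R.add_mem hr hs, ?_⟩⟩
    simp only; ring

end Adic

/-! ### Hensel's lemma as a property of a topology -/

section Hensel

/-- The topology satisfies Hensel's lemma, in the form of bounded roots: the polynomials
`1 + X + ∑ cᵢ Xⁱ⁺²` with small coefficients `cᵢ` have roots in a bounded set. -/
def IsHenselianFor {K : Type u} [Field K] (τ : TopologicalSpace K) : Prop :=
  ∀ n : ℕ, ∃ B : Set K, IsBddFor τ B ∧ ∃ W ∈ @nhds K τ 0, ∀ c : Fin n → K, (∀ i, c i ∈ W) →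
    ∃ z ∈ B, 1 + z + ∑ i, c i * z ^ (i.1 + 2) = 0

/-- The polynomial `X ^ (n + 1) + X ^ n + ∑ cᵢ X ^ (n - 1 - i)`. -/
noncomputable def reversedPoly {A : Type*} [CommRing A] {n : ℕ} (c : Fin n → A) : A[X] :=
  X ^ (n + 1) + (X ^ n + ∑ i, C (c i) * X ^ (n - 1 - i.1))

theorem reversedPoly_monic {A : Type*} [CommRing A] {n : ℕ} (c : Fin n → A) :
    (reversedPoly c).Monic := by
  refine monic_X_pow_add ?_
  refine lt_of_le_of_lt (b := (n : WithBot ℕ)) ?_ (by exact_mod_cast n.lt_succ_self)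
  refine (degree_add_le _ _).trans (max_le (degree_X_pow_le n) ?_)
  refine (degree_sum_le Finset.univ fun i : Fin n =>
    C (c i) * X ^ (n - 1 - i.1)).trans (Finset.sup_le fun i _ => ?_)
  refine (degree_C_mul_X_pow_le _ _).trans ?_
  exact_mod_cast (by omega : n - 1 - i.1 ≤ n)

theorem reversedPoly_map {A B : Type*} [CommRing A] [CommRing B] (f : A →+* B) {n : ℕ}
    (c : Fin n → A) : (reversedPoly c).map f = reversedPoly (fun i => f (c i)) := by
  simp [reversedPoly, Polynomial.map_sum]

/-- The substitution `z = w⁻¹` trades the non-monic equation of `IsHenselianFor` for a monic one. At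
`c = 0` the latter has the simple root `-1`, so Hensel's lemma and étaleness apply to it. -/
theorem reversedPoly_eval {K : Type*} [Field K] {n : ℕ} (c : Fin n → K) {w : K} (hw : w ≠ 0) :
    (reversedPoly c).eval w = w ^ (n + 1) * (1 + w⁻¹ + ∑ i, c i * w⁻¹ ^ (i.1 + 2)) := by
  simp only [reversedPoly, eval_add, eval_pow, eval_X, eval_finsetSum, eval_mul, eval_C, mul_add,
    Finset.mul_sum, mul_one]
  rw [← add_assoc]
  congr 1
  · rw [pow_succ, mul_inv_cancel_right₀ hw]
  · refine Finset.sum_congr rfl fun i _ => ?_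
    have : n + 1 = (n - 1 - i.1) + (i.1 + 2) := by have := i.2; omega
    rw [this, pow_add, inv_pow]
    field_simp

theorem reversedPoly_zero_eval {A : Type*} [CommRing A] (n : ℕ) :
    (reversedPoly (0 : Fin n → A)).eval (-1) = 0 := by
  simp [reversedPoly, pow_succ]

theorem reversedPoly_zero_derivative_eval {A : Type*} [CommRing A] (n : ℕ) :
    (reversedPoly (0 : Fin n → A)).derivative.eval (-1) = (-1) ^ n := by
  rcases n with - | n
  · simp [reversedPoly]
  · simp [reversedPoly, pow_succ]
    ring

variable {K : Type u} [Field K] [τ : TopologicalSpace K]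

theorem IsBddFor.tendsto_mul {B : Set K} (hB : IsBddFor τ B) {α : Type*} {l : Filter α}
    {f g : α → K} (hf : Tendsto f l (𝓝 0)) (hg : ∀ᶠ q in l, g q ∈ B) :
    Tendsto (fun q => f q * g q) l (𝓝 0) := by
  intro U hU
  obtain ⟨V, hV, h⟩ := hB U hU
  exact ((hf.eventually_mem hV).and hg).mono fun q hq => h _ hq.1 _ hq.2

/-- Put `y = (e₀ / e₁) z`. Then `∑ eᵢ yⁱ` becomes `e₀ (1 + z + ∑ cᵢ zⁱ⁺²)` with `cᵢ = e₀ⁱ⁺¹ eᵢ₊₂ /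
e₁ⁱ⁺²`, which tends to 0 with `e₀`. The root `z` stays bounded while `e₀ / e₁` tends to 0, so `y`
tends to 0. -/
theorem IsHenselianFor.exists_root [IsTopologicalDivisionRing K] [T2Space K]
    (H : IsHenselianFor τ) {α : Type*} {l : Filter α} (n : ℕ) {e : ℕ → α → K} {ε : ℕ → K}
    (he : ∀ i, Tendsto (e i) l (𝓝 (ε i))) (h0 : ε 0 = 0) (h1 : ε 1 ≠ 0) :
    ∃ y : α → K, Tendsto y l (𝓝 0) ∧
      ∀ᶠ q in l, ∑ i ∈ Finset.range (n + 2), e i q * y q ^ i = 0 := by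
  obtain ⟨B, hB, W, hW, H⟩ := H n
  have hc : ∀ i : Fin n, Tendsto (fun q => e 0 q ^ (i.1 + 1) * e (i.1 + 2) q / e 1 q ^ (i.1 + 2)) l
      (𝓝 0) := by
    intro i
    have := ((((he 0).pow (i.1 + 1)).mul (he (i.1 + 2))).div ((he 1).pow (i.1 + 2))
      (pow_ne_zero _ h1))
    rw [h0, zero_pow i.1.succ_ne_zero, zero_mul, zero_div] at this
    exact this
  have hc' := Filter.eventually_all.2 fun i => (hc i).eventually_mem hW
  obtain ⟨z, hz⟩ := Filter.skolem.1 (hc'.mono fun q hq => H _ hq)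
  have hd : Tendsto (fun q => e 0 q / e 1 q) l (𝓝 0) := by
    have := (he 0).div (he 1) h1
    rw [h0, zero_div] at this
    exact this
  refine ⟨_, hB.tendsto_mul hd (hz.mono fun q h => h.1), ?_⟩
  filter_upwards [hz, (he 1).eventually_ne h1] with q hq hq1
  rw [Finset.sum_range_succ', Finset.sum_range_succ', Finset.sum_range]
  have h2 := congr(e 0 q * $(hq.2))
  rw [mul_zero, mul_add, Finset.mul_sum] at h2
  rw [← h2, add_assoc, add_comm]
  congr 1
  · simp only [zero_add, pow_one, pow_zero, mul_one]
    rw [← mul_assoc, mul_div_cancel₀ _ hq1]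
    ring
  · refine Finset.sum_congr rfl fun i _ => ?_
    rw [mul_pow, div_pow]
    ring

end Hensel

/-! ### Henselian local rings give henselian topologies -/

section AdicHensel

variable {L : Type u} [Field L] (R : Subring L)

/-- For coefficients in `m R`, with `m` a nonunit, the reversed polynomial reduces to `Xⁿ⁺¹ + Xⁿ`.
Its simple root `-1` lifts to a unit of `R`, whose inverse lies in the bounded set `R`. -/
theorem isHenselianFor_adicTopology (hR : R ≠ ⊤) [HenselianLocalRing R] [IsFractionRing R L] :
    IsHenselianFor (adicTopology R) := by
  have hB := isBasic_subring R hR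
  rw [adicTopology_eq R hR]
  obtain ⟨m, hm0, hm⟩ := exists_ne_zero_not_isUnit R hR
  have hm0' : (m : L) ≠ 0 := fun h => hm0 (Subtype.ext h)
  intro n
  refine ⟨_, hB.isBddFor 1, _, hB.scale_mem_nhds hm0', fun c hc => ?_⟩
  choose r hr hc using hc
  let c' : Fin n → R := fun i => m * ⟨r i, hr i⟩
  have hmem : ∀ i, c' i ∈ IsLocalRing.maximalIdeal R := fun i =>
    Ideal.mul_mem_right _ _ ((IsLocalRing.mem_maximalIdeal _).2 hm)
  have hres : (fun i => IsLocalRing.residue R (c' i)) = 0 :=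
    funext fun i => (IsLocalRing.residue_eq_zero_iff _).2 (hmem i)
  obtain ⟨w, hw, hw1⟩ := HenselianLocalRing.is_henselian (reversedPoly c') (reversedPoly_monic c')
    (-1) (by
      rw [← IsLocalRing.residue_eq_zero_iff, ← eval_map_apply, reversedPoly_map, hres]
      simpa using reversedPoly_zero_eval n)
    (by
      rw [← IsLocalRing.residue_ne_zero_iff_isUnit, ← eval_map_apply, ← derivative_map,
        reversedPoly_map, hres]
      simp [reversedPoly_zero_derivative_eval])
  have hwu : IsUnit w := by
    rw [← IsLocalRing.residue_ne_zero_iff_isUnit]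
    rw [← IsLocalRing.residue_eq_zero_iff, map_sub, sub_eq_zero] at hw1
    simp [hw1]
  obtain ⟨v, hv⟩ := isUnit_iff_exists_inv.1 hwu
  have hv' : (w : L) * v = 1 := congr(($hv : R).1)
  have hw0 : (w : L) ≠ 0 := left_ne_zero_of_mul_eq_one hv'
  refine ⟨v, ⟨v, v.2, one_mul _⟩, ?_⟩
  have h1 : (reversedPoly c).eval (w : L) = 0 := by
    have : c = fun i => R.subtype (c' i) := funext fun i => (hc i).symm
    rw [this, ← reversedPoly_map, ← Subring.subtype_apply, eval_map_apply, hw]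
    simp
  rw [reversedPoly_eval _ hw0, inv_eq_of_mul_eq_one_right hv'] at h1
  exact (mul_eq_zero.1 h1).resolve_left (pow_ne_zero _ hw0)

end AdicHensel

/-! ### Standard étale algebras and their points in a field -/

section StandardEtale

variable {A B K : Type u} [CommRing A] [CommRing B] [Field K]

/-- Étale algebras are locally standard étale, in terms of homomorphisms to a field. -/
theorem exists_root_data_of_etale (φ : A →+* B) (hφ : φ.Etale) (ψ : B →+* K) :
    ∃ P Q : A[X], P.Monic ∧
      (∃ a : K, P.eval₂ (ψ.comp φ) a = 0 ∧
        P.derivative.eval₂ (ψ.comp φ) a * Q.eval₂ (ψ.comp φ) a ≠ 0) ∧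
      ∀ (χ : A →+* K) (a : K), P.eval₂ χ a = 0 → P.derivative.eval₂ χ a * Q.eval₂ χ a ≠ 0 →
        ∃ ψ' : B →+* K, ψ'.comp φ = χ := by
  algebraize [φ]
  have : (RingHom.ker ψ).IsPrime := RingHom.ker_isPrime ψ
  -- The kernel of `ψ` is the point of `Spec B` near which a standard étale presentation is needed;
  -- `h` lies outside it, so `ψ` extends to the localization.
  obtain ⟨h, hh, hstd⟩ := Algebra.IsEtaleAt.exists_isStandardEtale (R := A) (RingHom.ker ψ)
  obtain ⟨E⟩ := hstd.nonempty_standardEtalePresentation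
  let ψ₁ : Localization.Away h →+* K :=
    IsLocalization.Away.lift h (g := ψ) (IsUnit.mk0 _ fun h0 => hh h0)
  have hψ₁ : ψ₁.comp (algebraMap A (Localization.Away h)) = ψ.comp φ := by
    rw [IsScalarTower.algebraMap_eq A B, ← RingHom.comp_assoc, IsLocalization.Away.lift_comp]
    rfl
  have key : ∀ F : A[X], F.eval₂ (ψ.comp φ) (ψ₁ E.x) = ψ₁ (aeval E.x F) := by
    intro F
    rw [← hψ₁, aeval_def, hom_eval₂]
  refine ⟨E.f, E.g, E.monic_f, ⟨ψ₁ E.x, ?_, ?_⟩, ?_⟩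
  · rw [key, E.hasMap.1, map_zero]
  · rw [key, key, ← map_mul]
    exact ((E.hasMap.isUnit_derivative_f.mul E.hasMap.2).map ψ₁).ne_zero
  · intro χ a h1 h2
    let _ := χ.toAlgebra
    have hm : E.HasMap a := ⟨h1, IsUnit.mk0 _ (right_ne_zero_of_mul h2)⟩
    let l : Localization.Away h →ₐ[A] K := (E.lift a hm).comp E.equivRing.toAlgHom
    refine ⟨l.toRingHom.comp (algebraMap B _), RingHom.ext fun x => ?_⟩
    have h3 := l.commutes x
    rwa [IsScalarTower.algebraMap_apply A B] at h3

/-- The standard étale pair `(P, P' Q)`. -/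
@[reducible] noncomputable def etalePair (P Q : A[X]) (hP : P.Monic) : StandardEtalePair A :=
  -- The entries `Q, 0, 1` witness `P' · Q + P · 0 = (P' Q) ^ 1`, so that `P'` becomes invertible.
  ⟨P, hP, P.derivative * Q, Q, 0, 1, by simp⟩

theorem exists_hom_etalePair_iff (P Q : A[X]) (hP : P.Monic) (χ : A →+* K) (a : K) :
    (∃ ψ : (etalePair P Q hP).Ring →+* K, ψ.comp (algebraMap A _) = χ ∧
      ψ (etalePair P Q hP).X = a) ↔
      P.eval₂ χ a = 0 ∧ P.derivative.eval₂ χ a * Q.eval₂ χ a ≠ 0 := by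
  constructor
  · rintro ⟨ψ, rfl, rfl⟩
    have h := (etalePair P Q hP).hasMap_X
    rw [← hom_eval₂, ← hom_eval₂, ← hom_eval₂, ← map_mul]
    refine ⟨?_, ?_⟩
    · have h1 := h.1
      rw [aeval_def] at h1
      rw [h1, map_zero]
    · have := (h.2.map ψ).ne_zero
      rwa [map_mul] at this
  · rintro ⟨h1, h2⟩
    let _ := χ.toAlgebra
    have hm : (etalePair P Q hP).HasMap a :=
      ⟨h1, IsUnit.mk0 _ (by rw [map_mul]; exact h2)⟩
    exact ⟨((etalePair P Q hP).lift a hm).toRingHom,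
      RingHom.ext fun x => ((etalePair P Q hP).lift a hm).commutes x,
      (etalePair P Q hP).lift_X a hm⟩

end StandardEtale

/-! ### Points of varieties and local form of étale images -/

section Points

variable {K : Type u} [Field K] (X : Over (Spec (CommRingCat.of K)))

/-- The morphism of schemes underlying a `K`-point. -/
noncomputable abbrev Points.toHom {X : Over (Spec (CommRingCat.of K))} (p : Points X) :
    Spec (CommRingCat.of K) ⟶ X.left := p.left

/-- The `K`-point given by a section of the structure morphism. -/
noncomputable def Points.ofHom {X : Over (Spec (CommRingCat.of K))}
    (g : Spec (CommRingCat.of K) ⟶ X.left) (h : g ≫ X.hom = 𝟙 _) : Points X := Over.homMk g h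

theorem Points.toHom_comp {X : Over (Spec (CommRingCat.of K))} (p : Points X) :
    p.toHom ≫ X.hom = 𝟙 _ := Over.w p

theorem Points.ext_toHom {X : Over (Spec (CommRingCat.of K))} {p q : Points X}
    (h : p.toHom = q.toHom) : p = q := Over.OverMorphism.ext h

theorem mem_range_mapPoints_iff {X Y : Over (Spec (CommRingCat.of K))} (f : Y ⟶ X)
    (p : Points X) : p ∈ Set.range (mapPoints f) ↔
      ∃ g : Spec (CommRingCat.of K) ⟶ Y.left, g ≫ f.left = p.toHom := by
  constructor
  · rintro ⟨y, rfl⟩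
    exact ⟨y.toHom, rfl⟩
  · rintro ⟨g, hg⟩
    refine ⟨Points.ofHom g ?_, Points.ext_toHom hg⟩
    rw [← Over.w f, ← Category.assoc, hg, p.toHom_comp]

/-- The unique point of the spectrum of a field. -/
def specPoint (K : Type u) [Field K] : Spec (CommRingCat.of K) := (⊥ : PrimeSpectrum K)

theorem mem_pointsIn_iff {W : X.left.Opens} {p : Points X} :
    p ∈ pointsIn X W ↔ p.toHom (specPoint K) ∈ W := by
  constructor
  · intro h
    exact h (show specPoint K ∈ (⊤ : (Spec (CommRingCat.of K)).Opens) from trivial)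
  · intro h x _
    have : x = specPoint K := Subsingleton.elim (α := PrimeSpectrum K) _ _
    rw [this]
    exact h

/-- Evaluation of regular functions at a `K`-point. -/
noncomputable def evalHom (W : X.left.Opens) (p : pointsIn X W) :
    Γ(X.left, W) ⟶ CommRingCat.of K :=
  p.1.toHom.appLE W ⊤ p.2 ≫ (Scheme.ΓSpecIso (CommRingCat.of K)).hom

theorem evalHom_apply (W : X.left.Opens) (p : pointsIn X W) (f : Γ(X.left, W)) :
    (evalHom X W p).hom f = evalAt X W f p := rfl

variable {X}

theorem point_left_eq {W : X.left.Opens} (hW : IsAffineOpen W) (p : pointsIn X W) :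
    p.1.toHom = Spec.map (evalHom X W p) ≫ hW.fromSpec := by
  have h := IsAffineOpen.SpecMap_appLE_fromSpec p.1.toHom hW
    (isAffineOpen_top (Spec (CommRingCat.of K))) p.2
  rw [evalHom, Spec.map_comp, Category.assoc, h, IsAffineOpen.fromSpec_top,
    Scheme.isoSpec_Spec_inv, ← Category.assoc, ← Spec.map_comp]
  simp

theorem mem_pointsIn_of_left_eq {W : X.left.Opens} (hW : IsAffineOpen W) {p : Points X}
    {φ : Γ(X.left, W) ⟶ CommRingCat.of K} (h : p.toHom = Spec.map φ ≫ hW.fromSpec) :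
    p ∈ pointsIn X W := by
  rw [mem_pointsIn_iff, h]
  have : (Spec.map φ ≫ hW.fromSpec) (specPoint K) ∈ Set.range hW.fromSpec :=
    ⟨Spec.map φ (specPoint K), rfl⟩
  rwa [hW.range_fromSpec] at this

theorem evalHom_eq_of_left_eq {W : X.left.Opens} (hW : IsAffineOpen W) {p : Points X}
    {φ : Γ(X.left, W) ⟶ CommRingCat.of K} (h : p.toHom = Spec.map φ ≫ hW.fromSpec) :
    evalHom X W ⟨p, mem_pointsIn_of_left_eq hW h⟩ = φ := by
  have h1 := point_left_eq hW ⟨p, mem_pointsIn_of_left_eq hW h⟩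
  rw [h, cancel_mono] at h1
  exact (Spec.map_injective h1).symm

theorem evalHom_mapPoints {Y : Over (Spec (CommRingCat.of K))} (f : Y ⟶ X) {W : X.left.Opens}
    {V : Y.left.Opens} (e : V ≤ f.left ⁻¹ᵁ W) (y : pointsIn Y V)
    (hy : mapPoints f y.1 ∈ pointsIn X W) :
    evalHom X W ⟨mapPoints f y.1, hy⟩ = f.left.appLE W V e ≫ evalHom Y V y := by
  rw [evalHom, evalHom, ← Category.assoc]
  congr 1
  exact (Scheme.Hom.appLE_comp_appLE y.1.toHom f.left W V ⊤ e y.2).symm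

/-- The points of `W(K)` over which the étale `W`-scheme `P = 0`, `P' Q ≠ 0` has a `K`-point. -/
def rootSet (W : X.left.Opens) (P Q : Γ(X.left, W)[X]) : Set (Points X) :=
  {q | ∃ h : q ∈ pointsIn X W, ∃ x : K, P.eval₂ (evalHom X W ⟨q, h⟩).hom x = 0 ∧
    P.derivative.eval₂ (evalHom X W ⟨q, h⟩).hom x * Q.eval₂ (evalHom X W ⟨q, h⟩).hom x ≠ 0}

/-- Choosing an affine neighbourhood of a preimage of `p` reduces to étale algebras, where the
standard étale presentation replaces the covering scheme by two polynomials. -/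
theorem IsEtaleImage.exists_rootSet {S : Set (Points X)} (hS : IsEtaleImage X S)
    {W : X.left.Opens} (hW : IsAffineOpen W) {p : Points X} (hpS : p ∈ S) (hp : p ∈ pointsIn X W) :
    ∃ P Q : Γ(X.left, W)[X], P.Monic ∧ p ∈ rootSet W P Q ∧ rootSet W P Q ⊆ S := by
  obtain ⟨Y, f, hY, hf, rfl⟩ := hS
  obtain ⟨y, rfl⟩ := hpS
  have hyW : y.toHom (specPoint K) ∈ f.left ⁻¹ᵁ W := by
    rw [mem_pointsIn_iff] at hp
    simpa [mapPoints] using hp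
  obtain ⟨V, hV, hyV, hVW⟩ := exists_isAffineOpen_mem_and_subset hyW
  have hVW' : V ≤ f.left ⁻¹ᵁ W := hVW
  have hyV' : y ∈ pointsIn Y V := (mem_pointsIn_iff Y).2 hyV
  obtain ⟨P, Q, hP, ⟨a, ha, ha'⟩, H⟩ := exists_root_data_of_etale (f.left.appLE W V hVW').hom
    (f.left.etale_appLE hW hV hVW') (evalHom Y V ⟨y, hyV'⟩).hom
  refine ⟨P, Q, hP, ⟨hp, a, ?_⟩, ?_⟩
  · rw [evalHom_mapPoints f hVW' ⟨y, hyV'⟩ hp]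
    exact ⟨ha, ha'⟩
  · rintro q ⟨hq, x, hx, hx'⟩
    obtain ⟨χ, hχ⟩ := H _ x hx hx'
    have hχ' : f.left.appLE W V hVW' ≫ CommRingCat.ofHom χ = evalHom X W ⟨q, hq⟩ := by
      ext1; exact hχ
    have hz : (Spec.map (CommRingCat.ofHom χ) ≫ hV.fromSpec) ≫ f.left = q.toHom := by
      rw [Category.assoc, ← IsAffineOpen.SpecMap_appLE_fromSpec f.left hW hV hVW',
        ← Category.assoc, ← Spec.map_comp, hχ', ← point_left_eq hW ⟨q, hq⟩]
    exact (mem_range_mapPoints_iff f q).2 ⟨_, hz⟩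

/-- The étale `W`-scheme `P = 0`, `P' Q ≠ 0`, as a scheme over `K`. -/
noncomputable def rootScheme {W : X.left.Opens} (hW : IsAffineOpen W) (P Q : Γ(X.left, W)[X])
    (hP : P.Monic) : Over (Spec (CommRingCat.of K)) :=
  Over.mk ((Spec.map (CommRingCat.ofHom (algebraMap Γ(X.left, W) (etalePair P Q hP).Ring)) ≫
    hW.fromSpec) ≫ X.hom)

/-- The étale morphism from `rootScheme` to the base. -/
noncomputable def rootSchemeHom {W : X.left.Opens} (hW : IsAffineOpen W) (P Q : Γ(X.left, W)[X])
    (hP : P.Monic) : rootScheme hW P Q hP ⟶ X :=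
  Over.homMk (Spec.map (CommRingCat.ofHom (algebraMap Γ(X.left, W) (etalePair P Q hP).Ring)) ≫
    hW.fromSpec) rfl

theorem etale_rootSchemeHom {W : X.left.Opens} (hW : IsAffineOpen W) (P Q : Γ(X.left, W)[X])
    (hP : P.Monic) : Etale (rootSchemeHom hW P Q hP).left := by
  have : Etale (Spec.map (CommRingCat.ofHom
      (algebraMap Γ(X.left, W) (etalePair P Q hP).Ring))) := by
    rw [HasRingHomProperty.Spec_iff (P := @Etale)]
    exact (RingHom.etale_algebraMap).2 inferInstance
  change Etale (Spec.map _ ≫ hW.fromSpec)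
  infer_instance

theorem isVariety_rootScheme [IsVariety X] {W : X.left.Opens} (hW : IsAffineOpen W)
    (P Q : Γ(X.left, W)[X]) (hP : P.Monic) : IsVariety (rootScheme hW P Q hP) := by
  have h1 := etale_rootSchemeHom hW P Q hP
  have h2 : LocallyOfFiniteType X.hom := IsVariety.locallyOfFiniteType
  have : IsAffine (rootScheme hW P Q hP).left := isAffine_Spec _
  refine ⟨inferInstance, ?_, inferInstance⟩
  rw [← Over.w (rootSchemeHom hW P Q hP)]
  infer_instance

theorem range_rootSchemeHom {W : X.left.Opens} (hW : IsAffineOpen W) (P Q : Γ(X.left, W)[X])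
    (hP : P.Monic) : Set.range (mapPoints (rootSchemeHom hW P Q hP)) = rootSet W P Q := by
  ext q
  constructor
  · rintro ⟨z, rfl⟩
    obtain ⟨ψ, hψ⟩ : ∃ ψ : CommRingCat.of (etalePair P Q hP).Ring ⟶ CommRingCat.of K,
      z.toHom = Spec.map ψ := ⟨Spec.preimage z.toHom, (Spec.map_preimage _).symm⟩
    have h : (mapPoints (rootSchemeHom hW P Q hP) z).toHom =
        Spec.map (CommRingCat.ofHom (algebraMap _ _) ≫ ψ) ≫ hW.fromSpec := by
      rw [Spec.map_comp, Category.assoc, ← hψ]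
      rfl
    refine ⟨mem_pointsIn_of_left_eq hW h, ψ.hom (etalePair P Q hP).X, ?_⟩
    rw [evalHom_eq_of_left_eq hW h]
    exact (exists_hom_etalePair_iff P Q hP _ _).1 ⟨ψ.hom, rfl, rfl⟩
  · rintro ⟨hq, x, hx⟩
    obtain ⟨ψ, h1, h2⟩ := (exists_hom_etalePair_iff P Q hP _ x).2 hx
    have h3 : CommRingCat.ofHom (algebraMap _ _) ≫ CommRingCat.ofHom ψ = evalHom X W ⟨q, hq⟩ := by
      ext1; exact h1
    have h4 : Spec.map (CommRingCat.ofHom ψ) ≫ (rootSchemeHom hW P Q hP).left = q.toHom := by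
      change _ ≫ _ ≫ _ = _
      rw [← Category.assoc, ← Spec.map_comp, h3, ← point_left_eq hW ⟨q, hq⟩]
    exact (mem_range_mapPoints_iff _ q).2 ⟨Spec.map (CommRingCat.ofHom ψ), h4⟩

theorem isEtaleImage_rootSet [IsVariety X] {W : X.left.Opens} (hW : IsAffineOpen W)
    (P Q : Γ(X.left, W)[X]) (hP : P.Monic) : IsEtaleImage X (rootSet W P Q) :=
  ⟨_, rootSchemeHom hW P Q hP, isVariety_rootScheme hW P Q hP, etale_rootSchemeHom hW P Q hP,
    (range_rootSchemeHom hW P Q hP).symm⟩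

theorem isEtaleImage_univ [IsVariety X] : IsEtaleImage X Set.univ :=
  ⟨X, 𝟙 X, inferInstance, by rw [Over.id_left]; infer_instance, by
    ext x; simp only [Set.mem_univ, true_iff]; exact ⟨x, Category.comp_id x⟩⟩

/-- The fibre product over `X` is étale over `X`, and its universal property identifies its image on
points. -/
theorem IsEtaleImage.inter [hX : IsVariety X] {S T : Set (Points X)} (hS : IsEtaleImage X S)
    (hT : IsEtaleImage X T) : IsEtaleImage X (S ∩ T) := by
  obtain ⟨Y, f, hY, hf, rfl⟩ := hS
  obtain ⟨Z, g, hZ, hg, rfl⟩ := hT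
  have := hY.1
  have := hY.2
  have := hY.3
  have := hZ.1
  have := hZ.2
  have := hZ.3
  let k : Limits.pullback f.left g.left ⟶ X.left := Limits.pullback.fst f.left g.left ≫ f.left
  have hk : k = Limits.pullback.snd f.left g.left ≫ g.left := Limits.pullback.condition
  have hke : Etale k := by infer_instance
  have hkX : k ≫ X.hom = Limits.pullback.fst f.left g.left ≫ Y.hom := by
    rw [Category.assoc, Over.w f]
  have : IsSeparated (g.left ≫ X.hom) := by rw [Over.w g]; infer_instance
  have : QuasiCompact (g.left ≫ X.hom) := by rw [Over.w g]; infer_instance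
  have hX := hX.1
  have : IsSeparated g.left := IsSeparated.of_comp g.left X.hom
  have : QuasiCompact g.left := QuasiCompact.of_comp g.left X.hom
  refine ⟨Over.mk (k ≫ X.hom), Over.homMk k rfl, ⟨?_, ?_, ?_⟩, hke, ?_⟩
  · change IsSeparated (k ≫ X.hom)
    rw [hkX]
    infer_instance
  · change LocallyOfFiniteType (k ≫ X.hom)
    rw [hkX]
    infer_instance
  · change QuasiCompact (k ≫ X.hom)
    rw [hkX]
    infer_instance
  · ext p
    rw [Set.mem_inter_iff, mem_range_mapPoints_iff, mem_range_mapPoints_iff,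
      mem_range_mapPoints_iff, iff_comm]
    constructor
    · rintro ⟨a, ha⟩
      let a' : Spec (CommRingCat.of K) ⟶ Limits.pullback f.left g.left := a
      have ha' : a' ≫ k = p.toHom := ha
      refine ⟨⟨a' ≫ Limits.pullback.fst f.left g.left, ?_⟩,
        ⟨a' ≫ Limits.pullback.snd f.left g.left, ?_⟩⟩
      · rw [← ha', Category.assoc]
      · rw [← ha', hk, Category.assoc]
    · rintro ⟨⟨a, ha⟩, b, hb⟩
      have h1 : Limits.pullback.lift a b (ha.trans hb.symm) ≫ k = p.toHom := by
        rw [Limits.pullback.lift_fst_assoc, ha]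
      exact ⟨Limits.pullback.lift a b (ha.trans hb.symm), h1⟩

theorem isOpen_etaleOpenTopology_iff [IsVariety X] {S : Set (Points X)} :
    IsOpen[etaleOpenTopology X] S ↔ ∀ p ∈ S, ∃ T, IsEtaleImage X T ∧ p ∈ T ∧ T ⊆ S := by
  let := etaleOpenTopology X
  have hb : TopologicalSpace.IsTopologicalBasis {U | IsEtaleImage X U} :=
    { exists_subset_inter := fun S hS T hT x hx => ⟨S ∩ T, hS.inter hT, hx, subset_rfl⟩
      sUnion_eq := Set.eq_univ_of_univ_subset fun x _ => ⟨_, isEtaleImage_univ, trivial⟩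
      eq_generateFrom := rfl }
  rw [hb.isOpen_iff]
  rfl

end Points

/-! ### Henselian topologies make étale images open -/

section PointsTopology

variable {K : Type u} [Field K] [τ : TopologicalSpace K] {X : Over (Spec (CommRingCat.of K))}

theorem isOpen_pointsTopology_iff {S : Set (Points X)} :
    IsOpen[pointsTopology τ X] S ↔ ∀ W : X.left.Opens, IsAffineOpen W →
      IsOpen[affineTopology τ X W] {p : pointsIn X W | p.1 ∈ S} := by
  rw [isOpen_iSup_iff]
  simp only [isOpen_coinduced, Subtype.forall]
  rfl

theorem continuous_evalAt (W : X.left.Opens) (f : Γ(X.left, W)) :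
    Continuous[affineTopology τ X W, τ] (evalAt X W f) :=
  continuous_iInf_dom continuous_induced_dom

/-- A polynomial whose coefficients and argument vary continuously has continuous values. -/
theorem tendsto_eval₂ [IsTopologicalRing K] {A : Type*} [CommRing A] {α : Type*} {l : Filter α}
    {χ : α → A →+* K} {χ₀ : A →+* K} (hχ : ∀ f, Tendsto (fun q => χ q f) l (𝓝 (χ₀ f)))
    (F : A[X]) {y : α → K} {y₀ : K} (hy : Tendsto y l (𝓝 y₀)) :
    Tendsto (fun q => F.eval₂ (χ q) (y q)) l (𝓝 (F.eval₂ χ₀ y₀)) := by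
  simp only [eval₂_eq_sum_range]
  exact tendsto_finsetSum _ fun i _ => (hχ _).mul (hy.pow i)

theorem hasseDeriv_map {A B : Type*} [CommRing A] [CommRing B] (f : A →+* B) (n : ℕ) (P : A[X]) :
    hasseDeriv n (P.map f) = (hasseDeriv n P).map f := by
  ext i
  simp [hasseDeriv_coeff]

/-- In a henselian topology, simple roots depend continuously on the coefficients. -/
theorem IsHenselianFor.eventually_root [IsTopologicalDivisionRing K] [T2Space K]
    (H : IsHenselianFor τ) {A : Type*} [CommRing A] {α : Type*} {l : Filter α}
    {χ : α → A →+* K} {χ₀ : A →+* K} (hχ : ∀ f, Tendsto (fun q => χ q f) l (𝓝 (χ₀ f)))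
    (P : A[X]) {a : K} (ha : P.eval₂ χ₀ a = 0) (ha' : P.derivative.eval₂ χ₀ a ≠ 0) :
    ∃ y : α → K, Tendsto y l (𝓝 a) ∧ ∀ᶠ q in l, P.eval₂ (χ q) (y q) = 0 := by
  -- Expand `P` at `a`: the Hasse derivatives are the Taylor coefficients, of which the constant one
  -- vanishes in the limit and the linear one does not.
  obtain ⟨y, hy, hy'⟩ := H.exists_root (l := l) P.natDegree
    (e := fun i q => (hasseDeriv i P).eval₂ (χ q) a) (ε := fun i => (hasseDeriv i P).eval₂ χ₀ a)
    (fun i => tendsto_eval₂ hχ _ tendsto_const_nhds) (by simpa using ha)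
    (by simpa [hasseDeriv_one] using ha')
  refine ⟨fun q => y q + a, by simpa using hy.add_const a, hy'.mono fun q hq => ?_⟩
  rw [eval₂_eq_eval_map, ← taylor_eval, eval_eq_sum_range' (n := P.natDegree + 2), ← hq]
  · refine Finset.sum_congr rfl fun i _ => ?_
    rw [taylor_coeff, hasseDeriv_map, Polynomial.eval_map]
  · rw [natDegree_taylor]
    exact (natDegree_map_le).trans_lt (by omega)

theorem IsEtaleImage.isOpen_pointsTopology [IsTopologicalDivisionRing K] [T2Space K]
    (H : IsHenselianFor τ) {S : Set (Points X)} (hS : IsEtaleImage X S) :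
    IsOpen[pointsTopology τ X] S := by
  rw [isOpen_pointsTopology_iff]
  intro W hW
  let := affineTopology τ X W
  rw [isOpen_iff_mem_nhds]
  rintro p hp
  obtain ⟨P, Q, hP, ⟨_, a, ha, ha'⟩, hsub⟩ := hS.exists_rootSet hW hp p.2
  have hχ : ∀ f, Tendsto (fun q : pointsIn X W => (evalHom X W q).hom f) (𝓝 p)
      (𝓝 ((evalHom X W p).hom f)) := fun f => (continuous_evalAt W f).tendsto p
  obtain ⟨y, hy, hy'⟩ := H.eventually_root hχ P ha (left_ne_zero_of_mul ha')
  have h1 := (tendsto_eval₂ hχ P.derivative hy).mul (tendsto_eval₂ hχ Q hy)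
  filter_upwards [hy', h1.eventually_ne ha'] with q h2 h3
  exact hsub ⟨q.2, y q, h2, h3⟩

theorem pointsTopology_le_etaleOpenTopology [IsTopologicalDivisionRing K] [T2Space K]
    (H : IsHenselianFor τ) : pointsTopology τ X ≤ etaleOpenTopology X :=
  le_generateFrom fun _ hS => IsEtaleImage.isOpen_pointsTopology H hS

end PointsTopology

/-! ### A small étale image in the line makes the étale topology finer -/

section EtaleFiner

variable {K : Type u} [Field K]

/-- The étale image in the affine line given by `P = 0`, `P' Q ≠ 0`. -/
def lineSet (P Q : K[X][X]) : Set K :=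
  {t | ∃ x : K, P.eval₂ (evalRingHom t) x = 0 ∧
    P.derivative.eval₂ (evalRingHom t) x * Q.eval₂ (evalRingHom t) x ≠ 0}

variable {X : Over (Spec (CommRingCat.of K))}

theorem le_preimage_top (W : X.left.Opens) : W ≤ X.hom ⁻¹ᵁ ⊤ := fun _ _ => trivial

/-- Constants as regular functions. -/
noncomputable def constHom (W : X.left.Opens) : CommRingCat.of K ⟶ Γ(X.left, W) :=
  (Scheme.ΓSpecIso (CommRingCat.of K)).inv ≫ X.hom.appLE ⊤ W (le_preimage_top W)

theorem constHom_evalHom (W : X.left.Opens) (p : pointsIn X W) :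
    constHom W ≫ evalHom X W p = 𝟙 _ := by
  have h : X.hom.appLE ⊤ W (le_preimage_top W) ≫ p.1.toHom.appLE W ⊤ p.2 = 𝟙 _ := by
    refine (Scheme.Hom.appLE_comp_appLE p.1.toHom X.hom ⊤ W ⊤ (le_preimage_top W) p.2).trans ?_
    have : ∀ (g : Spec (CommRingCat.of K) ⟶ Spec (CommRingCat.of K)) (_ : g = 𝟙 _) (e),
        g.appLE ⊤ ⊤ e = 𝟙 _ := by
      rintro _ rfl e
      simp only [Scheme.Hom.appLE, Scheme.Hom.id_app]
      exact (Spec (CommRingCat.of K)).presheaf.map_id _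
    exact this _ p.1.toHom_comp _
  rw [constHom, evalHom, Category.assoc, ← Category.assoc (X.hom.appLE _ _ _), h, Category.id_comp,
    Iso.inv_hom_id]

theorem evalHom_constHom (W : X.left.Opens) (p : pointsIn X W) (c : K) :
    (evalHom X W p).hom ((constHom W).hom c) = c :=
  congr(($(constHom_evalHom W p)).hom c)

/-- With `P = X` and `Q = 1` the root is always 0 and `P' Q = 1`. This exhibits `W(K)` as an étale
image when `W` is affine. -/
theorem pointsIn_eq_rootSet (W : X.left.Opens) : pointsIn X W = rootSet W Polynomial.X 1 := by
  ext p
  exact ⟨fun h => ⟨h, 0, by simp, by simp⟩, fun h => h.1⟩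

/-- Base change along `f : W → 𝔸¹`: étale images in the line pull back to étale images in `W(K)`. -/
theorem mem_rootSet_map_iff (W : X.left.Opens) (f : Γ(X.left, W)) (P Q : K[X][X])
    (p : pointsIn X W) :
    p.1 ∈ rootSet W (P.map (eval₂RingHom (constHom W).hom f))
      (Q.map (eval₂RingHom (constHom W).hom f)) ↔ evalAt X W f p ∈ lineSet P Q := by
  have h : (evalHom X W p).hom.comp (eval₂RingHom (constHom W).hom f) =
      evalRingHom (evalAt X W f p) := by
    ext c
    · simpa using evalHom_constHom W p c
    · simpa using evalHom_apply X W p f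
  constructor
  · rintro ⟨_, x, h1, h2⟩
    refine ⟨x, ?_⟩
    rw [derivative_map] at h2
    rw [eval₂_map, h] at h1 h2
    rw [eval₂_map, h] at h2
    exact ⟨h1, h2⟩
  · rintro ⟨x, h1, h2⟩
    refine ⟨p.2, x, ?_⟩
    rw [derivative_map, eval₂_map, eval₂_map, eval₂_map, h]
    exact ⟨h1, h2⟩

variable [τ : TopologicalSpace K]

/-- If an étale image in the affine line is bounded and contains zero, then the étale open
topology refines the given field topology. -/
theorem etaleOpenTopology_le_pointsTopology [IsTopologicalRing K] [IsVariety X] {P Q : K[X][X]}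
    (hP : P.Monic) (h0 : 0 ∈ lineSet P Q)
    (hPQ : ∀ T ∈ 𝓝 (0 : K), ∃ a : K, a ≠ 0 ∧ ∀ u ∈ lineSet P Q, a * u ∈ T) :
    etaleOpenTopology X ≤ pointsTopology τ X := by
  rw [TopologicalSpace.le_def]
  intro S hS
  change IsOpen[pointsTopology τ X] S at hS
  rw [isOpen_pointsTopology_iff] at hS
  let := etaleOpenTopology X
  rw [isOpen_iff_mem_nhds]
  intro p hp
  obtain ⟨W, hW, hpW, -⟩ := exists_isAffineOpen_mem_and_subset
    (show p.toHom (specPoint K) ∈ (⊤ : X.left.Opens) from trivial)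
  have hpW' : p ∈ pointsIn X W := (mem_pointsIn_iff X).2 hpW
  have hWo : IsOpen (pointsIn X W) := by
    rw [pointsIn_eq_rootSet]
    exact TopologicalSpace.isOpen_generateFrom_of_mem (isEtaleImage_rootSet hW _ _ monic_X)
  have hle : (inferInstance : TopologicalSpace (pointsIn X W)) ≤ affineTopology τ X W := by
    refine le_iInf fun f => ?_
    rw [← continuous_iff_le_induced, continuous_iff_continuousAt]
    intro q V hV
    have hV' : (fun t => evalAt X W f q + t) ⁻¹' V ∈ 𝓝 (0 : K) := by
      refine (continuous_const_add _).continuousAt ?_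
      simpa using hV
    obtain ⟨a, ha, h⟩ := hPQ _ hV'
    -- Recentred at `q` and rescaled: `g` vanishes at `q`, and `g(r)` in the line set puts `f(r) -
    -- f(q) = a g(r)` in the prescribed neighbourhood of 0.
    let g : Γ(X.left, W) := (constHom W).hom a⁻¹ * (f - (constHom W).hom (evalAt X W f q))
    have hg : ∀ r, evalAt X W g r = a⁻¹ * (evalAt X W f r - evalAt X W f q) := by
      intro r
      rw [← evalHom_apply, map_mul, map_sub, evalHom_constHom, evalHom_constHom]
      rfl
    have hopen := TopologicalSpace.isOpen_generateFrom_of_mem (g := {U | IsEtaleImage X U})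
      (isEtaleImage_rootSet hW (P.map (eval₂RingHom (constHom W).hom g))
      (Q.map (eval₂RingHom (constHom W).hom g)) (hP.map _))
    have hmem := (hopen.preimage continuous_subtype_val).mem_nhds
      (show q ∈ Subtype.val ⁻¹' _ from (mem_rootSet_map_iff W g P Q q).2 (by simpa [hg] using h0))
    refine mem_map.2 (mem_of_superset hmem fun r hr => ?_)
    have := h _ ((mem_rootSet_map_iff W g P Q r).1 hr)
    rw [hg, mul_inv_cancel_left₀ ha] at this
    simpa using this
  have h1 := (TopologicalSpace.le_def.1 hle) _ (hS W hW)
  have h2 := hWo.isOpenMap_subtype_val _ h1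
  refine mem_of_superset (h2.mem_nhds ⟨⟨p, hpW'⟩, hp, rfl⟩) ?_
  rintro _ ⟨q, hq, rfl⟩
  exact hq

theorem inducesEtaleOpen_of_lineSet [IsTopologicalDivisionRing K] [T2Space K]
    (H : IsHenselianFor τ) {P Q : K[X][X]} (hP : P.Monic) (h0 : 0 ∈ lineSet P Q)
    (hPQ : ∀ T ∈ 𝓝 (0 : K), ∃ a : K, a ≠ 0 ∧ ∀ u ∈ lineSet P Q, a * u ∈ T) :
    InducesEtaleOpen τ := fun _ _ =>
  le_antisymm (pointsTopology_le_etaleOpenTopology H)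
    (etaleOpenTopology_le_pointsTopology hP h0 hPQ)

end EtaleFiner

/-! ### Affine spaces, and étale images in the line as subsets of the field -/

section AffineSpaces

variable {K : Type u} [Field K]

theorem mem_pointsIn_top {X : Over (Spec (CommRingCat.of K))} (p : Points X) :
    p ∈ pointsIn X ⊤ := fun _ _ => trivial

theorem pointsIn_mono {X : Over (Spec (CommRingCat.of K))} {V W : X.left.Opens} (h : W ≤ V) :
    pointsIn X W ⊆ pointsIn X V := fun _ hp =>
  (mem_pointsIn_iff X).2 (h ((mem_pointsIn_iff X).1 hp))

theorem evalAt_map {X : Over (Spec (CommRingCat.of K))} {V W : X.left.Opens} (h : W ≤ V)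
    (f : Γ(X.left, V)) (p : pointsIn X W) :
    evalAt X W ((X.left.presheaf.map (homOfLE h).op).hom f) p = 
      evalAt X V f ⟨p.1, pointsIn_mono h p.2⟩ := by
  have h1 := Scheme.Hom.map_appLE p.1.toHom p.2 (homOfLE h).op
  exact congr((Scheme.ΓSpecIso (CommRingCat.of K)).hom.hom ($(h1).hom f))

theorem isOpen_pointsTopology_preimage [τ : TopologicalSpace K]
    {X : Over (Spec (CommRingCat.of K))} (f : Γ(X.left, ⊤)) {T : Set K} (hT : IsOpen T) :
    IsOpen[pointsTopology τ X] {p | evalAt X ⊤ f ⟨p, mem_pointsIn_top p⟩ ∈ T} := by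
  rw [isOpen_pointsTopology_iff]
  intro W hW
  let := affineTopology τ X W
  have := hT.preimage (continuous_evalAt W ((X.left.presheaf.map (homOfLE le_top).op).hom f))
  convert this using 1
  ext p
  rw [Set.mem_preimage, evalAt_map]
  rfl

theorem evalAt_Spec {A : CommRingCat.{u}} (s : Spec A ⟶ Spec (CommRingCat.of K))
    {p : Points (Over.mk s)} {ψ : A ⟶ CommRingCat.of K} (hp : p.toHom = Spec.map ψ) (a : A) :
    evalAt (Over.mk s) ⊤ ((Scheme.ΓSpecIso A).inv.hom a) ⟨p, mem_pointsIn_top p⟩ = ψ.hom a := by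
  have h1 : ∀ (g : Spec (CommRingCat.of K) ⟶ Spec A) (_ : g = Spec.map ψ) (e),
      (Scheme.ΓSpecIso A).inv ≫ g.appLE ⊤ ⊤ e ≫ (Scheme.ΓSpecIso (CommRingCat.of K)).hom = ψ := by
    rintro _ rfl e
    have : (Spec.map ψ).appLE ⊤ ⊤ e = (Spec.map ψ).appTop := Scheme.Hom.appLE_eq_app _
    rw [this, Scheme.ΓSpecIso_naturality, Iso.inv_hom_id_assoc]
  exact congr(($(h1 p.toHom hp fun _ _ => trivial)).hom a)

variable (K) in
/-- The spectrum of a `K`-algebra as a scheme over `K`. -/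
noncomputable abbrev specOver (A : Type u) [CommRing A] [Algebra K A] :
    Over (Spec (CommRingCat.of K)) :=
  Over.mk (Spec.map (CommRingCat.ofHom (algebraMap K A)))

instance isVariety_specOver (A : Type u) [CommRing A] [Algebra K A] [Algebra.FiniteType K A] :
    IsVariety (specOver K A) := by
  refine ⟨?_, ?_, ?_⟩
  · change IsSeparated (Spec.map _)
    infer_instance
  · change LocallyOfFiniteType (Spec.map _)
    rw [HasRingHomProperty.Spec_iff (P := @LocallyOfFiniteType)]
    exact RingHom.finiteType_algebraMap.2 inferInstance
  · change QuasiCompact (Spec.map _)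
    infer_instance

variable {A : Type u} [CommRing A] [Algebra K A]

/-- The `K`-point of `Spec A` given by a homomorphism `A → K`. -/
noncomputable def pointOfAlgHom (χ : A →ₐ[K] K) : Points (specOver K A) :=
  Points.ofHom (Spec.map (CommRingCat.ofHom χ.toRingHom)) (by
    change Spec.map _ ≫ Spec.map _ = _
    rw [← Spec.map_comp, ← Spec.map_id]
    congr 1
    ext1
    exact χ.comp_algebraMap)

theorem evalAt_pointOfAlgHom (χ : A →ₐ[K] K) (f : Γ((specOver K A).left, ⊤)) :
    evalAt (specOver K A) ⊤ f ⟨pointOfAlgHom χ, mem_pointsIn_top _⟩ =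
      χ ((Scheme.ΓSpecIso (CommRingCat.of A)).hom.hom f) := by
  have h1 : f = (Scheme.ΓSpecIso (CommRingCat.of A)).inv.hom
      ((Scheme.ΓSpecIso (CommRingCat.of A)).hom.hom f) :=
    (congr(($((Scheme.ΓSpecIso (CommRingCat.of A)).hom_inv_id)).hom f)).symm
  conv_lhs => rw [h1]
  exact evalAt_Spec _ (ψ := CommRingCat.ofHom χ.toRingHom) rfl _

/-- Regular functions on the affine scheme `Spec A` are elements of `A`, so a family of points with
continuous coordinates is a continuous map into the chart `⊤`. -/
theorem isOpen_pointOfAlgHom_preimage [τ : TopologicalSpace K] {α : Type*} [TopologicalSpace α]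
    (χ : α → A →ₐ[K] K) (hχ : ∀ a, Continuous fun q => χ q a) {S : Set (Points (specOver K A))}
    (hS : IsOpen[pointsTopology τ (specOver K A)] S) :
    IsOpen {q | pointOfAlgHom (χ q) ∈ S} := by
  rw [isOpen_pointsTopology_iff] at hS
  let := affineTopology τ (specOver K A) ⊤
  have hc : Continuous (fun q => (⟨pointOfAlgHom (χ q), mem_pointsIn_top _⟩ :
      pointsIn (specOver K A) ⊤)) := by
    refine continuous_iInf_rng.2 fun f => continuous_induced_rng.2 ?_
    refine (hχ ((Scheme.ΓSpecIso (CommRingCat.of A)).hom.hom f)).congr fun q => ?_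
    exact (evalAt_pointOfAlgHom (χ q) f).symm
  exact (hS ⊤ (isAffineOpen_top (Spec (CommRingCat.of A)))).preimage hc

/-- The regular functions on `Spec A`. -/
noncomputable abbrev toGlobal (A : Type u) [CommRing A] [Algebra K A] :
    A →+* Γ((specOver K A).left, ⊤) :=
  (Scheme.ΓSpecIso (CommRingCat.of A)).inv.hom

noncomputable abbrev fromGlobal (A : Type u) [CommRing A] [Algebra K A] :
    Γ((specOver K A).left, ⊤) →+* A :=
  (Scheme.ΓSpecIso (CommRingCat.of A)).hom.hom

theorem fromGlobal_comp_toGlobal : (fromGlobal (K := K) A).comp (toGlobal (K := K) A) =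
    RingHom.id A :=
  congr(($((Scheme.ΓSpecIso (CommRingCat.of A)).inv_hom_id)).hom)

theorem mem_rootSet_pointOfAlgHom_iff (P Q : Γ((specOver K A).left, ⊤)[X]) (χ : A →ₐ[K] K) :
    pointOfAlgHom χ ∈ rootSet (X := specOver K A) ⊤ P Q ↔ ∃ x : K,
      (P.map (fromGlobal (K := K) A)).eval₂ χ.toRingHom x = 0 ∧
      (P.map (fromGlobal (K := K) A)).derivative.eval₂ χ.toRingHom x *
        (Q.map (fromGlobal (K := K) A)).eval₂ χ.toRingHom x ≠ 0 := by
  have h : (evalHom (specOver K A) ⊤ ⟨pointOfAlgHom χ, mem_pointsIn_top _⟩).hom =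
      χ.toRingHom.comp (fromGlobal (K := K) A) :=
    RingHom.ext fun f => evalAt_pointOfAlgHom χ f
  simp only [derivative_map, eval₂_map, ← h]
  exact ⟨fun ⟨_, x, hx⟩ => ⟨x, hx⟩, fun ⟨x, hx⟩ => ⟨mem_pointsIn_top _, x, hx⟩⟩

theorem lineSet_eq_preimage (P Q : Γ((specOver K K[X]).left, ⊤)[X]) :
    {t : K | pointOfAlgHom (aeval t) ∈ rootSet (X := specOver K K[X]) ⊤ P Q} =
      lineSet (P.map (fromGlobal (K := K) K[X])) (Q.map (fromGlobal (K := K) K[X])) := by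
  ext t
  exact mem_rootSet_pointOfAlgHom_iff P Q (aeval t)

theorem lineSet_eq_preimage' (P Q : K[X][X]) :
    {t : K | pointOfAlgHom (aeval t) ∈ rootSet (X := specOver K K[X]) ⊤
      (P.map (toGlobal (K := K) K[X])) (Q.map (toGlobal (K := K) K[X]))} = lineSet P Q := by
  rw [lineSet_eq_preimage, Polynomial.map_map, Polynomial.map_map, fromGlobal_comp_toGlobal,
    Polynomial.map_id, Polynomial.map_id]

theorem IsEtaleImage.image {X Y : Over (Spec (CommRingCat.of K))} (f : Y ⟶ X) [Etale f.left]
    {S : Set (Points Y)} (hS : IsEtaleImage Y S) : IsEtaleImage X (mapPoints f '' S) := by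
  obtain ⟨Z, g, hZ, hg, rfl⟩ := hS
  refine ⟨Z, g ≫ f, hZ, ?_, ?_⟩
  · rw [Over.comp_left]
    infer_instance
  · rw [← Set.range_comp]
    congr 1

variable [τ : TopologicalSpace K]

/-- Turns smallness of étale neighbourhoods in `𝔸¹` into a pair of polynomials, which can be
transferred between a field and an elementary extension. -/
theorem InducesEtaleOpen.exists_lineSet_subset (hτ : InducesEtaleOpen τ) {T : Set K}
    (hT : T ∈ 𝓝 0) : ∃ P Q : K[X][X], P.Monic ∧ 0 ∈ lineSet P Q ∧ lineSet P Q ⊆ T := by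
  have h1 := isOpen_pointsTopology_preimage (X := specOver K K[X])
    (toGlobal (K := K) K[X] Polynomial.X) (isOpen_interior (s := T))
  have hX := isVariety_specOver (K := K) K[X]
  have hc : ∀ t : K, evalAt (specOver K K[X]) ⊤ (toGlobal (K := K) K[X] Polynomial.X)
      ⟨pointOfAlgHom (aeval t), mem_pointsIn_top _⟩ = t := fun t =>
    (evalAt_Spec _ (ψ := CommRingCat.ofHom (aeval t).toRingHom) rfl _).trans (aeval_X t)
  rw [hτ _ hX, isOpen_etaleOpenTopology_iff] at h1
  obtain ⟨S, hS, h0S, hST⟩ := h1 (pointOfAlgHom (aeval 0)) (by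
    rw [Set.mem_ofPred_eq, hc]; exact mem_interior_iff_mem_nhds.2 hT)
  obtain ⟨P, Q, hP, h0, hsub⟩ := hS.exists_rootSet (isAffineOpen_top (Spec (CommRingCat.of K[X])))
    h0S (mem_pointsIn_top _)
  refine ⟨P.map (fromGlobal (K := K) K[X]), Q.map (fromGlobal (K := K) K[X]), hP.map _, ?_, ?_⟩
  · rw [← lineSet_eq_preimage]
    exact h0
  · rw [← lineSet_eq_preimage]
    intro t ht
    have := hST (hsub ht)
    rw [Set.mem_ofPred_eq, hc] at this
    exact interior_subset this

theorem InducesEtaleOpen.isOpen_lineSet [IsTopologicalRing K] (hτ : InducesEtaleOpen τ)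
    {P Q : K[X][X]} (hP : P.Monic) : IsOpen (lineSet P Q) := by
  have hX := isVariety_specOver (K := K) K[X]
  have h1 := isEtaleImage_rootSet (X := specOver K K[X])
    (isAffineOpen_top (Spec (CommRingCat.of K[X]))) (P.map (toGlobal (K := K) K[X]))
    (Q.map (toGlobal (K := K) K[X])) (hP.map _)
  have h2 : IsOpen[etaleOpenTopology (specOver K K[X])] _ :=
    TopologicalSpace.isOpen_generateFrom_of_mem h1
  rw [← hτ _ hX] at h2
  rw [← lineSet_eq_preimage']
  refine isOpen_pointOfAlgHom_preimage (fun t : K => aeval t) (fun f => ?_) h2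
  simp only [coe_aeval_eq_eval]
  exact f.continuous

end AffineSpaces

/-! ### The root as a coordinate on the étale cover -/

section RootCoord

theorem comp_hom_eq_id {K : Type u} [Field K] {X Y : Over (Spec (CommRingCat.of K))} (f : Y ⟶ X)
    {q : Points X} {g : Spec (CommRingCat.of K) ⟶ Y.left} (h : g ≫ f.left = q.toHom) :
    g ≫ Y.hom = 𝟙 _ := by
  rw [← Over.w f, ← Category.assoc, h, q.toHom_comp]

variable {K : Type u} [Field K] {X : Over (Spec (CommRingCat.of K))} {W : X.left.Opens}
  (hW : IsAffineOpen W) (P Q : Γ(X.left, W)[X]) (hP : P.Monic)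

/-- The tautological root of `P` as a regular function on `rootScheme`. -/
noncomputable def rootCoord : Γ((rootScheme hW P Q hP).left, ⊤) :=
  (Scheme.ΓSpecIso (CommRingCat.of (etalePair P Q hP).Ring)).inv.hom (etalePair P Q hP).X

/-- The value of the tautological root at a `K`-point. -/
noncomputable def rootAt (z : Points (rootScheme hW P Q hP)) : K :=
  evalAt (rootScheme hW P Q hP) ⊤ (rootCoord hW P Q hP) ⟨z, mem_pointsIn_top z⟩

theorem rootAt_spec (z : Points (rootScheme hW P Q hP)) :
    ∃ h : mapPoints (rootSchemeHom hW P Q hP) z ∈ pointsIn X W,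
      P.eval₂ (evalHom X W ⟨_, h⟩).hom (rootAt hW P Q hP z) = 0 := by
  obtain ⟨ψ, hψ⟩ : ∃ ψ : CommRingCat.of (etalePair P Q hP).Ring ⟶ CommRingCat.of K,
    z.toHom = Spec.map ψ := ⟨Spec.preimage z.toHom, (Spec.map_preimage _).symm⟩
  have h : (mapPoints (rootSchemeHom hW P Q hP) z).toHom =
      Spec.map (CommRingCat.ofHom (algebraMap _ _) ≫ ψ) ≫ hW.fromSpec := by
    rw [Spec.map_comp, Category.assoc, ← hψ]
    rfl
  refine ⟨mem_pointsIn_of_left_eq hW h, ?_⟩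
  have h1 : rootAt hW P Q hP z = ψ.hom (etalePair P Q hP).X := evalAt_Spec _ hψ _
  rw [evalHom_eq_of_left_eq hW h, h1]
  exact ((exists_hom_etalePair_iff P Q hP _ _).1 ⟨ψ.hom, rfl, rfl⟩).1

theorem exists_rootAt_eq {q : Points X} (hq : q ∈ pointsIn X W) {x : K}
    (hx : P.eval₂ (evalHom X W ⟨q, hq⟩).hom x = 0)
    (hx' : P.derivative.eval₂ (evalHom X W ⟨q, hq⟩).hom x *
      Q.eval₂ (evalHom X W ⟨q, hq⟩).hom x ≠ 0) :
    ∃ z, mapPoints (rootSchemeHom hW P Q hP) z = q ∧ rootAt hW P Q hP z = x := by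
  obtain ⟨ψ, h1, h2⟩ := (exists_hom_etalePair_iff P Q hP _ x).2 ⟨hx, hx'⟩
  have h3 : CommRingCat.ofHom (algebraMap _ _) ≫ CommRingCat.ofHom ψ = evalHom X W ⟨q, hq⟩ := by
    ext1; exact h1
  have h4 : Spec.map (CommRingCat.ofHom ψ) ≫ (rootSchemeHom hW P Q hP).left = q.toHom := by
    change _ ≫ _ ≫ _ = _
    rw [← Category.assoc, ← Spec.map_comp, h3, ← point_left_eq hW ⟨q, hq⟩]
  refine ⟨Points.ofHom (Spec.map (CommRingCat.ofHom ψ)) (comp_hom_eq_id _ h4),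
    Points.ext_toHom h4, ?_⟩
  exact (evalAt_Spec _ (ψ := CommRingCat.ofHom ψ) rfl _).trans h2

end RootCoord

/-! ### An inducing locally bounded topology is henselian -/

section Bounded

variable {K : Type u} [Field K] [τ : TopologicalSpace K]

theorem IsBddFor.preimage_add_const [IsTopologicalRing K] {B : Set K} (hB : IsBddFor τ B) :
    IsBddFor τ {z | z + 1 ∈ B} := by
  intro U hU
  obtain ⟨V, hV, h⟩ := exists_nhds_half_neg hU
  obtain ⟨W, hW, h'⟩ := hB V hV
  refine ⟨W ∩ V, inter_mem hW hV, fun v hv z hz => ?_⟩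
  have := h _ (h' v hv.1 _ hz) v hv.2
  convert this using 1
  ring

/-- Over affine `n`-space, the nonzero simple roots of the universal reversed polynomial form an
étale cover. Points of the cover with root in a given open set form an étale-open set, and its image
in `Kⁿ` is open because étale morphisms compose. So roots near `-1` persist for small coefficients.
-/
theorem InducesEtaleOpen.isHenselianFor [IsTopologicalDivisionRing K] [T2Space K]
    (hτ : InducesEtaleOpen τ) (hB : IsLocallyBdd τ) : IsHenselianFor τ := by
  obtain ⟨B, hB0, hB⟩ := hB
  intro n
  -- The roots cluster at `-1` rather than 0, so the bounded set is `B` translated by `-1`.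
  refine ⟨_, hB.preimage_add_const, ?_⟩
  let A := MvPolynomial (Fin n) K
  let X := specOver K A
  have hX : IsVariety X := isVariety_specOver A
  have hW : IsAffineOpen (⊤ : X.left.Opens) := isAffineOpen_top (Spec (CommRingCat.of A))
  let P : Γ(X.left, ⊤)[X] := reversedPoly fun i => toGlobal (K := K) A (MvPolynomial.X i)
  have hP : P.Monic := reversedPoly_monic _
  let pt : (Fin n → K) → Points X := fun c => pointOfAlgHom (MvPolynomial.aeval c)
  have heval : ∀ (c : Fin n → K) (h : pt c ∈ pointsIn X ⊤),
      P.map (evalHom X ⊤ ⟨pt c, h⟩).hom = reversedPoly c := by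
    intro c h
    rw [reversedPoly_map]
    congr 1
    ext i
    refine (evalAt_pointOfAlgHom (MvPolynomial.aeval c) _).trans ?_
    have := congr($(fromGlobal_comp_toGlobal (K := K) (A := A)) (MvPolynomial.X i))
    refine (congrArg (MvPolynomial.aeval c) this).trans ?_
    simp
  have hY := isVariety_rootScheme hW P Polynomial.X hP
  have hf := etale_rootSchemeHom hW P Polynomial.X hP
  let V : Set K := {w | w ≠ 0 ∧ w⁻¹ + 1 ∈ interior B}
  have hV : IsOpen V := by
    rw [isOpen_iff_mem_nhds]
    rintro w ⟨hw, hwB⟩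
    have h1 : Tendsto (fun w : K => w⁻¹ + 1) (𝓝 w) (𝓝 (w⁻¹ + 1)) :=
      (tendsto_inv₀ hw).add_const 1
    filter_upwards [isOpen_ne.mem_nhds hw, h1 (isOpen_interior.mem_nhds hwB)] with x h2 h3
      using ⟨h2, h3⟩
  have h1 := isOpen_pointsTopology_preimage (rootCoord hW P Polynomial.X hP) hV
  rw [hτ _ hY, isOpen_etaleOpenTopology_iff] at h1
  have hroot : P.eval₂ (evalHom X ⊤ ⟨pt 0, mem_pointsIn_top _⟩).hom (-1) = 0 := by
    rw [eval₂_eq_eval_map, heval, reversedPoly_zero_eval]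
  have hroot' : P.derivative.eval₂ (evalHom X ⊤ ⟨pt 0, mem_pointsIn_top _⟩).hom (-1) *
      Polynomial.X.eval₂ (evalHom X ⊤ ⟨pt 0, mem_pointsIn_top _⟩).hom (-1) ≠ 0 := by
    rw [eval₂_eq_eval_map, ← derivative_map, heval, reversedPoly_zero_derivative_eval, eval₂_X]
    exact mul_ne_zero (pow_ne_zero _ (by simp)) (by simp)
  obtain ⟨z₀, hz₀, hz₀'⟩ := exists_rootAt_eq hW P Polynomial.X hP _ hroot hroot'
  obtain ⟨S, hS, hzS, hSV⟩ := h1 z₀ (by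
    change rootAt hW P Polynomial.X hP z₀ ∈ V
    rw [hz₀']
    exact ⟨by simp, by simpa [inv_neg, mem_interior_iff_mem_nhds] using hB0⟩)
  have h2 : IsOpen[etaleOpenTopology X] _ :=
    TopologicalSpace.isOpen_generateFrom_of_mem (hS.image (rootSchemeHom hW P Polynomial.X hP))
  rw [← hτ _ hX] at h2
  have h3 := isOpen_pointOfAlgHom_preimage (fun c : Fin n → K => MvPolynomial.aeval c)
    (fun f => by simpa [MvPolynomial.aeval_eq_eval] using MvPolynomial.continuous_eval f) h2
  have h4 := h3.mem_nhds (show (0 : Fin n → K) ∈ _ from ⟨z₀, hzS, hz₀⟩)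
  rw [nhds_pi, Filter.mem_pi] at h4
  obtain ⟨I, -, t, ht, hsub⟩ := h4
  refine ⟨⋂ i, t i, Filter.iInter_mem.2 ht, fun c hc => ?_⟩
  obtain ⟨z, hz, hzc⟩ := hsub (fun i _ => Set.mem_iInter.1 (hc i) i)
  obtain ⟨hw0, hwB⟩ : rootAt hW P Polynomial.X hP z ∈ V := hSV hz
  refine ⟨(rootAt hW P Polynomial.X hP z)⁻¹, interior_subset (s := B) hwB, ?_⟩
  obtain ⟨h5, h6⟩ := rootAt_spec hW P Polynomial.X hP z
  have h7 : ∀ (q : Points X) (h : q ∈ pointsIn X ⊤), q = pt c →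
      P.map (evalHom X ⊤ ⟨q, h⟩).hom = reversedPoly c := by
    rintro _ h rfl
    exact heval c h
  rw [eval₂_eq_eval_map, h7 _ h5 hzc, reversedPoly_eval _ hw0] at h6
  exact (mul_eq_zero.1 h6).resolve_left (pow_ne_zero _ hw0)

end Bounded

/-! ### Ultrapowers and Łoś's theorem for étale images -/

section Ultrapower

variable {K : Type u} [Field K] {α : Type u} (D : Ultrafilter α)

/-- The diagonal embedding of a field into its ultrapower. -/
def diagonal : K →+* (D : Filter α).Germ K where
  toFun x := (fun _ => x : α → K)
  map_one' := rfl
  map_mul' _ _ := rfl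
  map_zero' := rfl
  map_add' _ _ := rfl

/-- The ring homomorphism to germs. -/
def toGerm : (α → K) →+* (D : Filter α).Germ K where
  toFun f := f
  map_one' := rfl
  map_mul' _ _ := rfl
  map_zero' := rfl
  map_add' _ _ := rfl

theorem isElementaryExtension_diagonal :
    IsElementaryExtension (diagonal (K := K) D) := by
  let _ := FirstOrder.Ring.compatibleRingOfRing K
  let _ := FirstOrder.Ring.compatibleRingOfRing ((D : Filter α).Germ K)
  let M := (D : Filter α).Product fun _ => K
  let e₀ : FirstOrder.Language.ElementaryEmbedding FirstOrder.Language.ring K M :=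
    { toFun := fun x => ((fun _ => x : α → K) : M)
      map_formula' := fun n φ x => by
        refine (FirstOrder.Language.Ultraproduct.realize_formula_cast φ
          (fun i _ => x i)).trans ?_
        exact eventually_const }
  -- The ultraproduct structure and the one from the ring of germs live on the same type; they agree
  -- symbol by symbol.
  let e₁ : FirstOrder.Language.Equiv FirstOrder.Language.ring M ((D : Filter α).Germ K) :=
    { toEquiv := Equiv.refl _
      map_fun' := fun {n} f x => by
        obtain ⟨y, hy⟩ : ∃ y : Fin n → α → K, x = fun i => (y i : M) :=
          ⟨fun i => Quotient.out (x i), funext fun i => (Quotient.out_eq (x i)).symm⟩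
        subst hy
        refine (FirstOrder.Language.Ultraproduct.funMap_cast f y).trans ?_
        cases f <;> rfl
      map_rel' := fun {n} r => r.elim }
  exact ⟨e₁.toElementaryEmbedding.comp e₀, fun x => rfl⟩

theorem toGerm_surjective : Function.Surjective (toGerm (K := K) D) := fun x =>
  ⟨Quotient.out x, Quotient.out_eq x⟩

theorem toGerm_eq_iff {f g : α → K} : toGerm D f = toGerm D g ↔ ∀ᶠ i in D, f i = g i :=
  Filter.Germ.coe_eq

theorem toGerm_inv (f : α → K) : (toGerm D f)⁻¹ = toGerm D fun i => (f i)⁻¹ := rfl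

/-- Both sides are ring homomorphisms in `P`, so it suffices to compare them on constants and the
two variables. -/
theorem eval₂_toGerm (P : K[X][X]) (u x : α → K) :
    (P.map (mapRingHom (diagonal D))).eval₂ (evalRingHom (toGerm D u)) (toGerm D x) =
      toGerm D fun i => P.eval₂ (evalRingHom (u i)) (x i) := by
  let F : K[X][X] →+* (D : Filter α).Germ K :=
    (toGerm D).comp (RingHom.pi fun i => eval₂RingHom (evalRingHom (u i)) (x i))
  let G : K[X][X] →+* (D : Filter α).Germ K :=
    (eval₂RingHom (evalRingHom (toGerm D u)) (toGerm D x)).comp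
      (mapRingHom (mapRingHom (diagonal D)))
  have h : G = F := by
    refine Polynomial.ringHom_ext' (Polynomial.ringHom_ext' (RingHom.ext fun c => ?_) ?_) ?_
    · simp only [F, G, RingHom.comp_apply, coe_mapRingHom, coe_eval₂RingHom, map_C, eval₂_C,
        coe_evalRingHom, Polynomial.eval_C]
      have : (RingHom.pi fun i => eval₂RingHom (evalRingHom (u i)) (x i)) (C (C c)) =
          fun _ => c := funext fun i =>
        show (C (C c)).eval₂ (evalRingHom (u i)) (x i) = c by simp
      rw [this]
      rfl
    · simp only [F, G, RingHom.comp_apply, coe_mapRingHom, coe_eval₂RingHom, map_C, map_X, eval₂_C,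
        coe_evalRingHom, Polynomial.eval_X]
      exact congrArg (toGerm D) (funext fun i =>
        show u i = (C X).eval₂ (evalRingHom (u i)) (x i) by simp)
    · simp only [F, G, RingHom.comp_apply, coe_mapRingHom, coe_eval₂RingHom, map_X, eval₂_X]
      exact congrArg (toGerm D) (funext fun i =>
        show x i = X.eval₂ (evalRingHom (u i)) (x i) by simp)
  refine congr($h P).trans ?_
  simp only [F, RingHom.comp_apply]
  rfl

/-- Łoś's theorem by hand: roots chosen in almost every coordinate form a germ, and the ultrafilter
commutes with negation. -/
theorem mem_lineSet_toGerm_iff (P Q : K[X][X]) (u : α → K) :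
    toGerm D u ∈ lineSet (P.map (mapRingHom (diagonal D))) (Q.map (mapRingHom (diagonal D))) ↔
      ∀ᶠ i in D, u i ∈ lineSet P Q := by
  have h0 : ∀ f : α → K, toGerm D f = 0 ↔ ∀ᶠ i in D, f i = 0 := fun f => toGerm_eq_iff D (g := 0)
  unfold lineSet
  simp only [Set.mem_ofPred_eq]
  rw [(toGerm_surjective D).exists, Filter.skolem]
  refine exists_congr fun x => ?_
  rw [derivative_map, eval₂_toGerm, eval₂_toGerm, eval₂_toGerm, ← map_mul, Ne, h0, h0,
    ← Ultrafilter.eventually_not, ← Filter.eventually_and]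
  rfl

end Ultrapower

/-! ### The henselian local ring of germs with a limit -/

section Limits

variable {K : Type u} [Field K] [τ : TopologicalSpace K]

theorem limit_unique [T2Space K] {α : Type u} {D : Ultrafilter α} {f g : α → K} (h : toGerm D f = toGerm D g) {k l : K}
    (hf : Tendsto f D (𝓝 k)) (hg : Tendsto g D (𝓝 l)) : k = l :=
  tendsto_nhds_unique (hf.congr' ((toGerm_eq_iff D).1 h)) hg

/-- The index set is `K` itself, so the identity is a nonzero infinitesimal germ; multiplying by it
sends bounded germs to germs with limit 0. -/
theorem tendsto_infinitesimal_mul {D : Ultrafilter K} (hD : (D : Filter K) ≤ 𝓝[≠] 0) {B : Set K}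
    (hB : IsBddFor τ B) {f : K → K} (hf : ∀ᶠ i in D, f i ∈ B) :
    Tendsto (fun i => i * f i) D (𝓝 0) :=
  hB.tendsto_mul (f := id) (hD.trans nhdsWithin_le_nhds) hf

end Limits

section LimitSubring

variable {K : Type u} [Field K] [τ : TopologicalSpace K] [IsTopologicalDivisionRing K]
  {α : Type u} (D : Ultrafilter α)

/-- The ring of germs that have a limit in `K`. -/
def limitSubring : Subring ((D : Filter α).Germ K) where
  carrier := {x | ∃ f : α → K, toGerm D f = x ∧ ∃ k, Tendsto f D (𝓝 k)}
  mul_mem' := by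
    rintro _ _ ⟨f, rfl, k, hf⟩ ⟨g, rfl, l, hg⟩
    exact ⟨f * g, map_mul _ _ _, k * l, hf.mul hg⟩
  one_mem' := ⟨1, map_one _, 1, tendsto_const_nhds⟩
  add_mem' := by
    rintro _ _ ⟨f, rfl, k, hf⟩ ⟨g, rfl, l, hg⟩
    exact ⟨f + g, map_add _ _ _, k + l, hf.add hg⟩
  zero_mem' := ⟨0, map_zero _, 0, tendsto_const_nhds⟩
  neg_mem' := by
    rintro _ ⟨f, rfl, k, hf⟩
    exact ⟨-f, map_neg _ _, -k, hf.neg⟩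

variable {D}

theorem toGerm_mem_limitSubring {f : α → K} {k : K} (h : Tendsto f D (𝓝 k)) :
    toGerm D f ∈ limitSubring (K := K) D := ⟨f, rfl, k, h⟩

variable [T2Space K]

theorem isUnit_limitSubring_iff {x : limitSubring (K := K) D} {f : α → K}
    (hx : toGerm D f = x) {k : K} (h : Tendsto f D (𝓝 k)) : IsUnit x ↔ k ≠ 0 := by
  rw [isUnit_iff_exists_inv]
  constructor
  · rintro ⟨⟨_, g, rfl, l, hg⟩, hxg⟩ rfl
    have h1 : toGerm D (f * g) = toGerm D 1 := by
      rw [map_mul, hx, map_one]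
      exact congr(($hxg : limitSubring (K := K) D).1)
    have := limit_unique h1 (h.mul hg) (l := 1) tendsto_const_nhds
    simp at this
  · intro hk
    refine ⟨⟨_, toGerm_mem_limitSubring (h.inv₀ hk)⟩, Subtype.ext ?_⟩
    change x.1 * toGerm D _ = 1
    rw [← hx, ← map_mul, ← map_one (toGerm D), toGerm_eq_iff]
    filter_upwards [h.eventually_ne hk] with i hi
    simp [hi]

instance isLocalRing_limitSubring : IsLocalRing (limitSubring (K := K) D) := by
  refine IsLocalRing.of_isUnit_or_isUnit_one_sub_self fun x => ?_
  obtain ⟨_, f, rfl, k, hf⟩ := x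
  by_cases hk : k = 0
  · right
    refine (isUnit_limitSubring_iff (f := 1 - f) (k := 1 - k) ?_ (tendsto_const_nhds.sub hf)).2
      (by simp [hk])
    rw [map_sub, map_one]
    rfl
  · left
    exact (isUnit_limitSubring_iff rfl hf).2 hk

theorem mem_maximalIdeal_limitSubring_iff {x : limitSubring (K := K) D} {f : α → K}
    (hx : toGerm D f = x) {k : K} (h : Tendsto f D (𝓝 k)) :
    x ∈ IsLocalRing.maximalIdeal (limitSubring (K := K) D) ↔ k = 0 := by
  rw [IsLocalRing.mem_maximalIdeal, mem_nonunits_iff, isUnit_limitSubring_iff hx h, not_not]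

/-- The Taylor coefficients at the approximate root are germs whose limits have vanishing constant
and nonvanishing linear term. The coordinatewise root from `IsHenselianFor.exists_root` has limit 0,
hence is the germ of a correction in the maximal ideal. -/
theorem henselianLocalRing_limitSubring (H : IsHenselianFor τ) :
    HenselianLocalRing (limitSubring (K := K) D) where
  is_henselian P hP a₀ h0 h1 := by
    choose e he ε hε using fun i : ℕ => ((taylor a₀ P).coeff i).2
    have hε0 : ε 0 = 0 := by
      rw [← taylor_coeff_zero] at h0
      exact (mem_maximalIdeal_limitSubring_iff (he 0) (hε 0)).1 h0
    have hε1 : ε 1 ≠ 0 := by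
      rw [← taylor_coeff_one] at h1
      exact (isUnit_limitSubring_iff (he 1) (hε 1)).1 h1
    obtain ⟨y, hy, hy'⟩ := H.exists_root P.natDegree hε hε0 hε1
    let b : limitSubring (K := K) D := ⟨_, toGerm_mem_limitSubring hy⟩
    refine ⟨b + a₀, ?_, ?_⟩
    · rw [IsRoot.def, ← taylor_eval, eval_eq_sum_range' (n := P.natDegree + 2)
        (by rw [natDegree_taylor]; omega)]
      refine Subtype.ext ?_
      have h2 : toGerm D (∑ i ∈ Finset.range (P.natDegree + 2), e i * y ^ i) = toGerm D 0 := by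
        rw [toGerm_eq_iff]
        filter_upwards [hy'] with q hq
        simpa using hq
      rw [map_zero, map_sum] at h2
      simp only [map_mul, map_pow, he] at h2
      simpa using h2
    · rw [add_sub_cancel_right]
      exact (mem_maximalIdeal_limitSubring_iff rfl hy).2 rfl

end LimitSubring

section Infinitesimal

variable {K : Type u} [Field K] [τ : TopologicalSpace K] [IsTopologicalDivisionRing K]
  {D : Ultrafilter K}

theorem limitSubring_ne_top [T2Space K] (hD : (D : Filter K) ≤ 𝓝[≠] 0) : limitSubring (K := K) D ≠ ⊤ := by
  intro h
  obtain ⟨g, hg, k, hk⟩ : (toGerm D id)⁻¹ ∈ limitSubring (K := K) D := h ▸ Subring.mem_top _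
  have h0 : Tendsto (id : K → K) D (𝓝 0) := hD.trans nhdsWithin_le_nhds
  have h1 : toGerm D (id * g) = toGerm D 1 := by
    rw [map_mul, hg, toGerm_inv, ← map_mul, toGerm_eq_iff]
    filter_upwards [hD self_mem_nhdsWithin] with i hi
    have : i ≠ 0 := hi
    simp [this]
  have := limit_unique h1 (h0.mul hk) (l := 1) tendsto_const_nhds
  simp at this

/-- In each coordinate a small `c ≠ 0` brings both `c` and `c f` into a bounded neighbourhood.
Multiplying both by the infinitesimal makes them converge, so `f` is their quotient. -/
theorem isFractionRing_limitSubring (hD : (D : Filter K) ≤ 𝓝[≠] 0) (hB : IsLocallyBdd τ) :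
    IsFractionRing (limitSubring (K := K) D) ((D : Filter K).Germ K) := by
  obtain ⟨B, hB0, hB⟩ := hB
  have : FaithfulSMul (limitSubring (K := K) D) ((D : Filter K).Germ K) :=
    (faithfulSMul_iff_algebraMap_injective _ _).2 Subtype.coe_injective
  refine IsFractionRing.of_field _ _ fun x => ?_
  obtain ⟨f, rfl⟩ := toGerm_surjective D x
  have hne : (𝓝[≠] (0 : K)).NeBot := D.neBot.mono hD
  have hex : ∀ᶠ i in D, ∃ c, c ≠ 0 ∧ c ∈ B ∧ c * f i ∈ B := by
    refine Eventually.of_forall fun i => ?_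
    have h1 : Tendsto (fun c : K => c * f i) (𝓝 0) (𝓝 0) := by
      simpa using (tendsto_id (α := K) (x := 𝓝 0)).mul_const (f i)
    have h2 : ∀ᶠ c in 𝓝[≠] (0 : K), c ∈ B ∧ c * f i ∈ B :=
      nhdsWithin_le_nhds (inter_mem hB0 (h1 hB0))
    obtain ⟨c, hc, hc0⟩ := (h2.and self_mem_nhdsWithin).exists
    exact ⟨c, hc0, hc⟩
  obtain ⟨c, hc⟩ := Filter.skolem.1 hex
  refine ⟨⟨_, toGerm_mem_limitSubring
    (tendsto_infinitesimal_mul hD hB (hc.mono fun i h => h.2.2))⟩,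
    ⟨_, toGerm_mem_limitSubring (tendsto_infinitesimal_mul hD hB (hc.mono fun i h => h.2.1))⟩, ?_⟩
  change toGerm D f = toGerm D _ / toGerm D _
  rw [div_eq_mul_inv, toGerm_inv, ← map_mul, toGerm_eq_iff]
  filter_upwards [hc, hD self_mem_nhdsWithin] with i hi hi'
  have h1 : i ≠ 0 := hi'
  have h2 := hi.1
  simp only [Pi.mul_apply]
  field_simp

end Infinitesimal

theorem exists_henselian_of_inducesEtaleOpen {K : Type u} [Field K] (τ : TopologicalSpace K)
    (hτ : IsFieldTopology τ) (hτB : IsLocallyBdd τ) (hτE : InducesEtaleOpen τ) :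
    ∃ (L : Type u) (_ : Field L) (φ : K →+* L) (R : Subring L),
      IsElementaryExtension φ ∧ R ≠ ⊤ ∧ HenselianLocalRing R ∧ IsFractionRing R L ∧
        InducesEtaleOpen (adicTopology R) := by
  have := hτ.isTopologicalDivisionRing
  have := hτ.hausdorff
  have hne : (𝓝[≠] (0 : K)).NeBot := by
    rw [neBot_iff, Ne, ← isOpen_singleton_iff_punctured_nhds,
      ← discreteTopology_iff_isOpen_singleton_zero]
    exact hτ.not_discrete
  let D : Ultrafilter K := Ultrafilter.of (𝓝[≠] (0 : K))
  have hD : (D : Filter K) ≤ 𝓝[≠] 0 := Ultrafilter.of_le _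
  let L := (D : Filter K).Germ K
  let R : Subring L := limitSubring D
  have hR : R ≠ ⊤ := limitSubring_ne_top hD
  have hRH : HenselianLocalRing R := henselianLocalRing_limitSubring (hτE.isHenselianFor hτB)
  have hRF : IsFractionRing R L := isFractionRing_limitSubring hD hτB
  refine ⟨L, inferInstance, diagonal D, R, isElementaryExtension_diagonal D, hR, hRH, hRF, ?_⟩
  obtain ⟨B, hB0, hB⟩ := hτB
  obtain ⟨P, Q, hP, h0, hsub⟩ := hτE.exists_lineSet_subset hB0
  have hH := isHenselianFor_adicTopology R hR
  have hbasic := isBasic_subring R hR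
  rw [adicTopology_eq R hR] at hH ⊢
  let := hbasic.topology
  have := hbasic.isTopologicalDivisionRing
  have := hbasic.isFieldTopology.hausdorff
  have hid : toGerm D id ≠ 0 := by
    rw [← map_zero (toGerm D), Ne, toGerm_eq_iff, ← Ultrafilter.eventually_not]
    exact hD self_mem_nhdsWithin
  refine inducesEtaleOpen_of_lineSet hH (hP.map (mapRingHom (diagonal D)))
    (Q := Q.map (mapRingHom (diagonal D))) ?_ fun T hT => ?_
  · rw [← map_zero (toGerm D), mem_lineSet_toGerm_iff]
    exact Eventually.of_forall fun _ => h0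
  · obtain ⟨c, hc, h⟩ := hbasic.mem_nhds_zero_iff.1 hT
    -- The transferred set consists of bounded germs; the infinitesimal moves it into `R`, and `c`
    -- moves `R` into `T`.
    refine ⟨c * toGerm D id, mul_ne_zero hc hid, fun u hu => ?_⟩
    obtain ⟨f, rfl⟩ := toGerm_surjective D u
    rw [mem_lineSet_toGerm_iff] at hu
    rw [mul_assoc, ← map_mul]
    exact h _ (toGerm_mem_limitSubring
      (tendsto_infinitesimal_mul hD hB (hu.mono fun i hi => hsub hi)))

/-! ### Uniform definability in the language of rings -/

section FirstOrder

/-- A predicate on tuples of elements of fields given by a formula in the language of rings. -/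
def IsFirstOrder {ι : Type} (Φ : ∀ (F : Type u) [Field F], (ι → F) → Prop) : Prop :=
  ∃ φ : Language.ring.Formula ι, ∀ (F : Type u) [Field F] (v : ι → F),
    (letI := Ring.compatibleRingOfRing F; φ.Realize v) ↔ Φ F v

/-- A function on tuples of elements of fields given by a term in the language of rings. -/
def IsRingTerm {ι : Type} (t : ∀ (F : Type u) [Field F], (ι → F) → F) : Prop :=
  ∃ s : Language.ring.Term ι, ∀ (F : Type u) [Field F] (v : ι → F),
    (letI := Ring.compatibleRingOfRing F; s.realize v) = t F v

variable {ι κ : Type}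

namespace IsRingTerm

variable {s t : ∀ (F : Type u) [Field F], (ι → F) → F}

theorem var (i : ι) : IsRingTerm.{u} fun _ _ v => v i :=
  ⟨Language.Term.var i, fun _ _ _ => rfl⟩

theorem zero : IsRingTerm.{u} fun _ _ (_ : ι → _) => 0 :=
  ⟨0, fun F _ v => let _ := Ring.compatibleRingOfRing F; Ring.realize_zero v⟩

theorem one : IsRingTerm.{u} fun _ _ (_ : ι → _) => 1 :=
  ⟨1, fun F _ v => let _ := Ring.compatibleRingOfRing F; Ring.realize_one v⟩

theorem add (hs : IsRingTerm s) (ht : IsRingTerm t) : IsRingTerm fun F _ v => s F v + t F v := by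
  obtain ⟨s', hs⟩ := hs
  obtain ⟨t', ht⟩ := ht
  refine ⟨s' + t', fun F _ v => ?_⟩
  let _ := Ring.compatibleRingOfRing F
  rw [Ring.realize_add, hs, ht]

theorem mul (hs : IsRingTerm s) (ht : IsRingTerm t) : IsRingTerm fun F _ v => s F v * t F v := by
  obtain ⟨s', hs⟩ := hs
  obtain ⟨t', ht⟩ := ht
  refine ⟨s' * t', fun F _ v => ?_⟩
  let _ := Ring.compatibleRingOfRing F
  rw [Ring.realize_mul, hs, ht]

theorem neg (hs : IsRingTerm s) : IsRingTerm fun F _ v => -s F v := by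
  obtain ⟨s', hs⟩ := hs
  refine ⟨-s', fun F _ v => ?_⟩
  let _ := Ring.compatibleRingOfRing F
  rw [Ring.realize_neg, hs]

theorem pow (hs : IsRingTerm s) (n : ℕ) : IsRingTerm fun F _ v => s F v ^ n := by
  induction n with
  | zero => simpa only [pow_zero] using one
  | succ n ih => simpa only [pow_succ] using ih.mul hs

theorem sum {α : Type*} (S : Finset α) {s : α → ∀ (F : Type u) [Field F], (ι → F) → F}
    (hs : ∀ i ∈ S, IsRingTerm (s i)) : IsRingTerm fun F _ v => ∑ i ∈ S, s i F v := by
  classical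
  induction S using Finset.induction_on with
  | empty => simpa only [Finset.sum_empty] using zero
  | insert a S ha ih =>
    simp only [Finset.sum_insert ha]
    exact (hs a (Finset.mem_insert_self _ _)).add
      (ih fun i hi => hs i (Finset.mem_insert_of_mem hi))

theorem intCast (n : ℤ) : IsRingTerm.{u} fun _ _ (_ : ι → _) => (n : _) := by
  have h : ∀ n : ℕ, IsRingTerm.{u} fun _ _ (_ : ι → _) => (n : _) := by
    intro n
    induction n with
    | zero => simpa only [Nat.cast_zero] using zero
    | succ n ih => simpa only [Nat.cast_succ] using ih.add one
  cases n with
  | ofNat n => simpa only [Int.ofNat_eq_natCast, Int.cast_natCast] using h n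
  | negSucc n => simpa only [Int.cast_negSucc] using (h (n + 1)).neg

theorem aeval (G : MvPolynomial κ ℤ) (σ : κ → ι) :
    IsRingTerm.{u} fun _ _ v => MvPolynomial.aeval (fun i => v (σ i)) G := by
  induction G using MvPolynomial.induction_on with
  | C n => simpa using intCast n
  | add p q hp hq => simpa only [map_add] using hp.add hq
  | mul_X p i hp => simpa only [map_mul, MvPolynomial.aeval_X] using hp.mul (var (σ i))

end IsRingTerm

namespace IsFirstOrder

theorem eq {s t : ∀ (F : Type u) [Field F], (ι → F) → F} (hs : IsRingTerm s)
    (ht : IsRingTerm t) : IsFirstOrder fun F _ v => s F v = t F v := by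
  obtain ⟨s', hs⟩ := hs
  obtain ⟨t', ht⟩ := ht
  refine ⟨s'.equal t', fun F _ v => ?_⟩
  let _ := Ring.compatibleRingOfRing F
  rw [Language.Formula.realize_equal, hs, ht]

variable {Φ Ψ : ∀ (F : Type u) [Field F], (ι → F) → Prop}

theorem not (h : IsFirstOrder Φ) : IsFirstOrder fun F _ v => ¬ Φ F v := by
  obtain ⟨φ, h⟩ := h
  refine ⟨φ.not, fun F _ v => ?_⟩
  let _ := Ring.compatibleRingOfRing F
  rw [Language.Formula.realize_not, h]

theorem and (h : IsFirstOrder Φ) (h' : IsFirstOrder Ψ) :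
    IsFirstOrder fun F _ v => Φ F v ∧ Ψ F v := by
  obtain ⟨φ, h⟩ := h
  obtain ⟨ψ, h'⟩ := h'
  refine ⟨φ ⊓ ψ, fun F _ v => ?_⟩
  let _ := Ring.compatibleRingOfRing F
  rw [Language.Formula.realize_inf, h, h']

theorem imp (h : IsFirstOrder Φ) (h' : IsFirstOrder Ψ) :
    IsFirstOrder fun F _ v => Φ F v → Ψ F v := by
  simpa only [not_and_not_right] using (h.and h'.not).not

theorem subst (h : IsFirstOrder Φ) {s : ι → ∀ (F : Type u) [Field F], (κ → F) → F}
    (hs : ∀ i, IsRingTerm (s i)) : IsFirstOrder fun F _ v => Φ F fun i => s i F v := by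
  obtain ⟨φ, h⟩ := h
  choose s' hs using hs
  refine ⟨Language.BoundedFormula.subst φ s', fun F _ v => ?_⟩
  let _ := Ring.compatibleRingOfRing F
  refine Iff.trans ?_ (h F _)
  simp only [← hs]
  exact Language.BoundedFormula.realize_subst

theorem exists_tuple [Finite κ] {Φ : ∀ (F : Type u) [Field F], (ι → F) → (κ → F) → Prop}
    (h : IsFirstOrder fun F _ (w : ι ⊕ κ → F) => Φ F (fun i => w (.inl i)) fun i => w (.inr i)) :
    IsFirstOrder fun F _ v => ∃ x, Φ F v x := by
  obtain ⟨φ, h⟩ := h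
  refine ⟨φ.iExs κ, fun F _ v => ?_⟩
  let _ := Ring.compatibleRingOfRing F
  rw [Language.Formula.realize_iExs]
  simp only [h]
  rfl

theorem forall_tuple [Finite κ] {Φ : ∀ (F : Type u) [Field F], (ι → F) → (κ → F) → Prop}
    (h : IsFirstOrder fun F _ (w : ι ⊕ κ → F) => Φ F (fun i => w (.inl i)) fun i => w (.inr i)) :
    IsFirstOrder fun F _ v => ∀ x, Φ F v x := by
  simpa only [not_exists_not] using (exists_tuple (Φ := fun F _ v x => ¬ Φ F v x) h.not).not

theorem ex {Φ : ∀ (F : Type u) [Field F], (ι → F) → F → Prop}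
    (h : IsFirstOrder fun F _ (w : ι ⊕ Unit → F) => Φ F (fun i => w (.inl i)) (w (.inr ()))) :
    IsFirstOrder fun F _ v => ∃ x, Φ F v x := by
  have := exists_tuple (Φ := fun F _ v (x : Unit → F) => Φ F v (x ())) h
  obtain ⟨φ, h⟩ := this
  exact ⟨φ, fun F _ v => (h F v).trans
    ⟨fun ⟨x, hx⟩ => ⟨x (), hx⟩, fun ⟨x, hx⟩ => ⟨fun _ => x, hx⟩⟩⟩

theorem all {Φ : ∀ (F : Type u) [Field F], (ι → F) → F → Prop}
    (h : IsFirstOrder fun F _ (w : ι ⊕ Unit → F) => Φ F (fun i => w (.inl i)) (w (.inr ()))) :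
    IsFirstOrder fun F _ v => ∀ x, Φ F v x := by
  simpa only [not_exists_not] using (ex (Φ := fun F _ v x => ¬ Φ F v x) h.not).not

end IsFirstOrder

theorem IsElementaryExtension.iff {K L : Type u} [Field K] [Field L] {f : K →+* L}
    (hf : IsElementaryExtension f) {Φ : ∀ (F : Type u) [Field F], (ι → F) → Prop}
    (h : IsFirstOrder Φ) (v : ι → K) : Φ L (fun i => f (v i)) ↔ Φ K v := by
  obtain ⟨φ, h⟩ := h
  obtain ⟨e, he⟩ := hf
  rw [← h, ← h]
  let _ := Ring.compatibleRingOfRing K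
  let _ := Ring.compatibleRingOfRing L
  have := e.map_formula φ v
  rw [← this]
  have h1 : e ∘ v = fun i => f (v i) := funext fun i => he (v i)
  rw [h1]

end FirstOrder

/-! ### Definable families of étale images in the line -/

section Families

variable {ι κ : Type}

/-- Specialization of the parameters of a family of polynomials. -/
noncomputable def specialize {F : Type u} [Field F] (v : ι → F) :
    (MvPolynomial ι ℤ)[X][X] →+* F[X][X] :=
  mapRingHom (mapRingHom (MvPolynomial.aeval v).toRingHom)

theorem isRingTerm_specialize (G : (MvPolynomial ι ℤ)[X][X]) (σ : ι → κ)
    {t x : ∀ (F : Type u) [Field F], (κ → F) → F} (ht : IsRingTerm t) (hx : IsRingTerm x) :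
    IsRingTerm fun F _ v => (specialize (fun i => v (σ i)) G).eval₂ (evalRingHom (t F v))
      (x F v) := by
  have h : ∀ (F : Type u) [Field F] (v : κ → F),
      (specialize (fun i => v (σ i)) G).eval₂ (evalRingHom (t F v)) (x F v) =
        ∑ j ∈ Finset.range (G.natDegree + 1), (∑ i ∈ Finset.range ((G.coeff j).natDegree + 1),
          MvPolynomial.aeval (fun i => v (σ i)) ((G.coeff j).coeff i) * t F v ^ i) *
            x F v ^ j := by
    intro F _ v
    rw [specialize, coe_mapRingHom, eval₂_map, eval₂_eq_sum_range]
    refine Finset.sum_congr rfl fun j _ => ?_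
    congr 1
    rw [RingHom.comp_apply, coe_mapRingHom, coe_evalRingHom, Polynomial.eval_map,
      eval₂_eq_sum_range]
    rfl
  simp only [h]
  exact .sum _ fun j _ => (IsRingTerm.sum _ fun i _ => (IsRingTerm.aeval _ σ).mul (ht.pow i)).mul
    (hx.pow j)

/-- The family of étale images in the line given by two families of polynomials. -/
def familySet (G H : (MvPolynomial ι ℤ)[X][X]) (F : Type u) [Field F] (v : ι → F) : Set F :=
  lineSet (specialize v G) (specialize v H)

theorem isFirstOrder_mem_familySet (G H : (MvPolynomial ι ℤ)[X][X]) (σ : ι → κ)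
    {t : ∀ (F : Type u) [Field F], (κ → F) → F} (ht : IsRingTerm t) :
    IsFirstOrder fun F _ v => t F v ∈ familySet G H F fun i => v (σ i) := by
  have h : ∀ (F : Type u) [Field F] (v : ι → F),
      derivative (specialize v G) = specialize v (derivative G) := fun F _ v => derivative_map _ _
  have e : ∀ E : (MvPolynomial ι ℤ)[X][X],
      IsRingTerm.{u} fun F _ (w : (ι ⊕ Unit) ⊕ Unit → F) =>
        (specialize (fun i => w (.inl (.inl i))) E).eval₂ (evalRingHom (w (.inl (.inr ()))))
          (w (.inr ())) := fun E =>
    isRingTerm_specialize E (fun i => Sum.inl (Sum.inl i)) (.var (Sum.inl (Sum.inr ())))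
      (.var (Sum.inr ()))
  have h1 : IsFirstOrder.{u} fun F _ (w : ι ⊕ Unit → F) =>
      w (.inr ()) ∈ familySet G H F fun i => w (.inl i) := by
    simp only [familySet, lineSet, Set.mem_ofPred_eq, h]
    exact .ex (.and (.eq (e G) .zero) (.not (.eq ((e _).mul (e H)) .zero)))
  exact h1.subst (s := Sum.elim (fun i _ _ v => v (σ i)) fun _ => t)
    (Sum.rec (fun i => .var (σ i)) fun _ => ht)

end Families

/-! ### First-order expression of basic, minimal and henselian -/

section FirstOrderFamilies

variable {ι κ : Type}

namespace IsFirstOrder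

variable {Φ Ψ : ∀ (F : Type u) [Field F], (ι → F) → Prop}

theorem congr (h : IsFirstOrder Φ) (H : ∀ (F : Type u) [Field F] (v : ι → F), Φ F v ↔ Ψ F v) :
    IsFirstOrder Ψ := by
  obtain ⟨φ, h⟩ := h
  exact ⟨φ, fun F _ v => (h F v).trans (H F v)⟩

theorem forall_finite {α : Type} [Finite α] {Φ : α → ∀ (F : Type u) [Field F], (ι → F) → Prop}
    (h : ∀ i, IsFirstOrder (Φ i)) : IsFirstOrder fun F _ v => ∀ i, Φ i F v := by
  choose φ h using h
  refine ⟨Language.Formula.iInf φ, fun F _ v => ?_⟩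
  let _ := Ring.compatibleRingOfRing F
  rw [Language.Formula.realize_iInf]
  exact forall_congr' fun i => h i F v

end IsFirstOrder

/-- A family of subsets of fields that is uniformly definable in the language of rings. -/
def IsFirstOrderFamily (U : ∀ (F : Type u) [Field F], (ι → F) → Set F) : Prop :=
  IsFirstOrder fun F _ (w : ι ⊕ Unit → F) => w (.inr ()) ∈ U F fun i => w (.inl i)

namespace IsFirstOrderFamily

variable {U : ∀ (F : Type u) [Field F], (ι → F) → Set F} (hU : IsFirstOrderFamily U)

include hU

theorem mem (σ : ι → κ) {t : ∀ (F : Type u) [Field F], (κ → F) → F} (ht : IsRingTerm t) :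
    IsFirstOrder fun F _ v => t F v ∈ U F fun i => v (σ i) :=
  IsFirstOrder.subst hU (s := Sum.elim (fun i _ _ v => v (σ i)) fun _ => t)
    (Sum.rec (fun i => .var (σ i)) fun _ => ht)

theorem isBasic (σ : ι → κ) : IsFirstOrder fun F _ v => IsBasic (U F fun i => v (σ i)) := by
  have h1 : IsFirstOrder fun F _ v => (0 : F) ∈ U F fun i => v (σ i) := hU.mem σ .zero
  have h2 : IsFirstOrder fun F _ v => ∃ u : F, u ∈ (U F fun i => v (σ i)) ∧ ¬ u = 0 :=
    .ex (.and (hU.mem _ (.var _)) (.not (.eq (.var _) .zero)))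
  have h3 : IsFirstOrder fun F _ v =>
      ∃ a : F, ¬ a = 0 ∧ ∀ u : F, u ∈ (U F fun i => v (σ i)) → ¬ a * u = 1 :=
    .ex (.and (.not (.eq (.var _) .zero)) (.all (.imp (hU.mem _ (.var _))
      (.not (.eq (.mul (.var _) (.var _)) .one)))))
  have h4 : IsFirstOrder fun F _ v => ∃ a : F, ¬ a = 0 ∧ ∀ u : F, u ∈ (U F fun i => v (σ i)) →
      -(a * u) ∈ U F fun i => v (σ i) :=
    .ex (.and (.not (.eq (.var _) .zero)) (.all (.imp (hU.mem _ (.var _))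
      (hU.mem _ (.neg (.mul (.var _) (.var _)))))))
  have h5 : IsFirstOrder fun F _ v => ∃ a : F, ¬ a = 0 ∧ ∀ u : F, u ∈ (U F fun i => v (σ i)) →
      ∀ u' : F, u' ∈ (U F fun i => v (σ i)) → a * u + a * u' ∈ U F fun i => v (σ i) :=
    .ex (.and (.not (.eq (.var _) .zero)) (.all (.imp (hU.mem _ (.var _))
      (.all (.imp (hU.mem _ (.var _))
        (hU.mem _ (.add (.mul (.var _) (.var _)) (.mul (.var _) (.var _)))))))))
  have h6 : IsFirstOrder fun F _ v => ∃ a : F, ¬ a = 0 ∧ ∀ u : F, u ∈ (U F fun i => v (σ i)) →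
      ∀ u' : F, u' ∈ (U F fun i => v (σ i)) → a * u * u' ∈ U F fun i => v (σ i) :=
    .ex (.and (.not (.eq (.var _) .zero)) (.all (.imp (hU.mem _ (.var _))
      (.all (.imp (hU.mem _ (.var _))
        (hU.mem _ (.mul (.mul (.var _) (.var _)) (.var _))))))))
  have h7 : IsFirstOrder fun F _ v => ∀ d : F, ¬ d = 0 → ∃ a : F, ¬ a = 0 ∧
      ∀ u : F, u ∈ (U F fun i => v (σ i)) →
        ∃ u' : F, u' ∈ (U F fun i => v (σ i)) ∧ (1 + a * u) * (1 + d * u') = 1 :=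
    .all (.imp (.not (.eq (.var _) .zero)) (.ex (.and (.not (.eq (.var _) .zero))
      (.all (.imp (hU.mem _ (.var _)) (.ex (.and (hU.mem _ (.var _))
        (.eq (.mul (.add .one (.mul (.var _) (.var _))) (.add .one (.mul (.var _) (.var _))))
          .one))))))))
  have h8 : IsFirstOrder fun F _ v => ∀ b : F, ¬ b = 0 → ∃ a : F, ¬ a = 0 ∧
      ∀ u : F, u ∈ (U F fun i => v (σ i)) → (a * u ∈ U F fun i => v (σ i)) ∧
        ∃ u' : F, u' ∈ (U F fun i => v (σ i)) ∧ a * u = b * u' :=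
    .all (.imp (.not (.eq (.var _) .zero)) (.ex (.and (.not (.eq (.var _) .zero))
      (.all (.imp (hU.mem _ (.var _)) (.and (hU.mem _ (.mul (.var _) (.var _)))
        (.ex (.and (hU.mem _ (.var _))
          (.eq (.mul (.var _) (.var _)) (.mul (.var _) (.var _)))))))))))
  exact (h1.and (h2.and (h3.and (h4.and (h5.and (h6.and (h7.and h8))))))).congr fun F _ v =>
    ⟨fun ⟨g1, g2, g3, g4, g5, g6, g7, g8⟩ => ⟨g1, g2, g3, g4, g5, g6, g7, g8⟩,
      fun ⟨g1, g2, g3, g4, g5, g6, g7, g8⟩ => ⟨g1, g2, g3, g4, g5, g6, g7, g8⟩⟩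

/-- Minimality is what survives the change of parameters: any two members that have it can be scaled
into each other, so they are commensurable. -/
theorem isBasic_and_minimal [Finite ι] (σ : ι → κ) : IsFirstOrder fun F _ v =>
    IsBasic (U F fun i => v (σ i)) ∧ ∀ w : ι → F, 0 ∈ U F w →
      ∃ a : F, ¬ a = 0 ∧ ∀ u : F, u ∈ (U F fun i => v (σ i)) → a * u ∈ U F w :=
  .and (hU.isBasic _) (.forall_tuple (.imp (hU.mem _ .zero)
    (.ex (.and (.not (.eq (.var _) .zero)) (.all (.imp (hU.mem _ (.var _))
      (hU.mem _ (.mul (.var _) (.var _)))))))))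

theorem exists_isBasic_and_minimal [Finite ι] : IsFirstOrder fun F _ (_ : Empty → F) =>
    ∃ v : ι → F, IsBasic (U F v) ∧ ∀ w : ι → F, 0 ∈ U F w →
      ∃ a : F, ¬ a = 0 ∧ ∀ u : F, u ∈ U F v → a * u ∈ U F w :=
  .exists_tuple (hU.isBasic_and_minimal Sum.inr)

/-- Quantification over bounded sets and neighbourhoods becomes quantification over the multiples `b
U` and `a U`. The degree is fixed, giving one formula for each `n`. -/
theorem henselian (n : ℕ) : IsFirstOrder fun F _ v => ∃ a : F, ¬ a = 0 ∧ ∃ b : F, ¬ b = 0 ∧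
    ∀ c : Fin n → F, (∀ i, c i ∈ U F v) → ∃ z : F, z ∈ U F v ∧
      1 + b * z + ∑ i, a * c i * (b * z) ^ (i.1 + 2) = 0 :=
  .ex (.and (.not (.eq (.var _) .zero)) (.ex (.and (.not (.eq (.var _) .zero))
    (.forall_tuple (.imp (.forall_finite fun _ => hU.mem _ (.var _))
      (.ex (.and (hU.mem _ (.var _)) (.eq (.add (.add .one (.mul (.var _) (.var _)))
        (.sum _ fun _ _ => .mul (.mul (.var _) (.var _)) (.pow (.mul (.var _) (.var _)) _)))
        .zero))))))))

end IsFirstOrderFamily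

theorem isFirstOrderFamily_familySet (G H : (MvPolynomial ι ℤ)[X][X]) :
    IsFirstOrderFamily.{u} (familySet G H) :=
  isFirstOrder_mem_familySet G H Sum.inl (.var (Sum.inr ()))

/-- Every polynomial is a specialization of a family with finitely many parameters. -/
theorem exists_specialize_eq {F : Type u} [Field F] {P : F[X][X]} (hP : P.Monic) (Q : F[X][X]) :
    ∃ (n : ℕ) (G H : (MvPolynomial (Fin n) ℤ)[X][X]) (v : Fin n → F), G.Monic ∧
      specialize v G = P ∧ specialize v H = Q := by
  classical
  -- The parameters are the coefficients themselves.
  let S : Finset F := P.coeffs.biUnion coeffs ∪ Q.coeffs.biUnion coeffs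
  let v : Fin S.card → F := fun i => S.equivFin.symm i
  have hv : ∀ x ∈ S, x ∈ Set.range (MvPolynomial.aeval (R := ℤ) v).toRingHom := fun x hx =>
    ⟨MvPolynomial.X (S.equivFin ⟨x, hx⟩), by simp [v]⟩
  have key : ∀ E : F[X][X], E.coeffs.biUnion coeffs ⊆ S →
      E ∈ lifts (mapRingHom (MvPolynomial.aeval (R := ℤ) v).toRingHom) := by
    intro E hE
    rw [lifts_iff_coeff_lifts]
    intro j
    have : E.coeff j ∈ lifts (MvPolynomial.aeval (R := ℤ) v).toRingHom := by
      rw [lifts_iff_coeff_lifts]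
      intro i
      by_cases h : (E.coeff j).coeff i = 0
      · exact ⟨0, by rw [h, map_zero]⟩
      · have hj : E.coeff j ≠ 0 := fun h0 => h (by rw [h0, coeff_zero])
        exact hv _ (hE (Finset.mem_biUnion.2 ⟨_, coeff_mem_coeffs hj, coeff_mem_coeffs h⟩))
    obtain ⟨g, hg⟩ := (mem_lifts _).1 this
    exact ⟨g, hg⟩
  -- A monic lift keeps every specialization monic, hence every member of the family an étale image.
  obtain ⟨G, hG, -, hGm⟩ := lifts_and_natDegree_eq_and_monic
    (key P Finset.subset_union_left) hP
  obtain ⟨H, hH⟩ := (mem_lifts _).1 (key Q Finset.subset_union_right)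
  exact ⟨_, G, H, v, hGm, hG, hH⟩

end FirstOrderFamilies

/-! ### Descent of the topology to the elementary subfield -/

section Descent

theorem exists_locallyBdd_of_henselian {K L : Type u} [Field K] [Field L] {φ : K →+* L}
    (hφ : IsElementaryExtension φ) (R : Subring L) (hR : R ≠ ⊤) [HenselianLocalRing R]
    [IsFractionRing R L] (hRE : InducesEtaleOpen (adicTopology R)) :
    ∃ τ : TopologicalSpace K, IsFieldTopology τ ∧ IsLocallyBdd τ ∧ InducesEtaleOpen τ := by
  have hH := isHenselianFor_adicTopology R hR
  have hbasic := isBasic_subring R hR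
  rw [adicTopology_eq R hR] at hH hRE
  let := hbasic.topology
  have := hbasic.isTopologicalDivisionRing
  have hRn : (R : Set L) ∈ 𝓝 0 := hbasic.mem_nhds_zero_iff.2 ⟨1, one_ne_zero, by simp⟩
  obtain ⟨P, Q, hP, h0, hsub⟩ := hRE.exists_lineSet_subset hRn
  obtain ⟨n, G, H, v, hG, rfl, rfl⟩ := exists_specialize_eq hP Q
  have hU := isFirstOrderFamily_familySet.{u} G H
  have hmonic : ∀ {F : Type u} [Field F] (w : Fin n → F), (specialize w G).Monic :=
    fun w => hG.map _
  have hopen : ∀ w : Fin n → L, 0 ∈ familySet G H L w →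
      ∃ a : L, a ≠ 0 ∧ ∀ r ∈ R, a * r ∈ familySet G H L w := fun w hw =>
    hbasic.mem_nhds_zero_iff.1 ((hRE.isOpen_lineSet (hmonic w)).mem_nhds hw)
  obtain ⟨a, ha, haU⟩ := hopen v h0
  have hUR : ∀ u ∈ familySet G H L v, u ∈ R := hsub
  have hv := isBasic_of_local R hR ha haU one_ne_zero (by simpa using hUR)
  -- In `L` the parameters `v` are minimal: their set lies in `R`, and every member containing 0 is
  -- open, so it contains a multiple of `R`.
  obtain ⟨p, hp⟩ := (hφ.iff hU.exists_isBasic_and_minimal Empty.elim).1 ⟨v, hv, fun w hw => by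
    obtain ⟨b, hb, h⟩ := hopen w hw
    exact ⟨b, hb, fun u hu => h u (hUR u hu)⟩⟩
  -- Returning to `L` with the parameters `p` from `K`: `a₁` scales their set into that of `v`,
  -- hence into `R`, and `a₂` scales `R` into their set.
  obtain ⟨hLp, hmin⟩ := (hφ.iff (hU.isBasic_and_minimal id) p).2 hp
  obtain ⟨a₁, ha₁, h₁⟩ := hmin v h0
  obtain ⟨a₂, ha₂, h₂⟩ := hopen _ hLp.zero_mem
  have hB := hp.1
  let τ := hB.topology
  have hτ := hB.isFieldTopology
  have := hτ.isTopologicalDivisionRing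
  have := hτ.hausdorff
  refine ⟨τ, hτ, hB.isLocallyBdd, inducesEtaleOpen_of_lineSet (P := specialize p G)
    (Q := specialize p H) (fun m => ?_) (hmonic p) hB.zero_mem
    fun T hT => hB.mem_nhds_zero_iff.1 hT⟩
  obtain ⟨b, hb, c, hc, h⟩ := (hφ.iff (hU.henselian m) p).1 <| by
    obtain ⟨B, hBB, W, hW, h⟩ := hH m
    obtain ⟨V, hV, hVB⟩ := hBB _ (hbasic.mem_nhds_zero_iff.2 ⟨a₂, ha₂, h₂⟩)
    obtain ⟨e, he, hVe⟩ := hbasic.mem_nhds_zero_iff.1 hV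
    obtain ⟨d, hd, hWd⟩ := hbasic.mem_nhds_zero_iff.1 hW
    -- Coefficients pass through `R` by `a₁` and into `W` by `d`; since `e B` lies in the set of
    -- `p`, each root `z` in `B` is `e⁻¹` times the member `e z`.
    refine ⟨d * a₁, mul_ne_zero hd ha₁, e⁻¹, inv_ne_zero he, fun c hc => ?_⟩
    obtain ⟨z, hz, h⟩ := h (fun i => d * (a₁ * c i)) fun i => hWd _ (hUR _ (h₁ _ (hc i)))
    have hez : e⁻¹ * (e * z) = z := inv_mul_cancel_left₀ he z
    refine ⟨e * z, hVB e (by simpa using hVe 1 R.one_mem) z hz, ?_⟩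
    simpa only [hez, mul_assoc] using h
  refine ⟨_, hB.isBddFor c, _, hB.scale_mem_nhds hb, fun t ht => ?_⟩
  choose t' ht' htt using ht
  obtain ⟨z, hz, h⟩ := h t' ht'
  refine ⟨c * z, ⟨z, hz, rfl⟩, ?_⟩
  simpa only [← htt] using h

end Descent

end EtaleOpen

theorem theorem1p5 (K : Type u) [Field K] :
    (∃ τ : TopologicalSpace K, EtaleOpen.IsFieldTopology τ ∧ EtaleOpen.IsLocallyBdd τ ∧
        EtaleOpen.InducesEtaleOpen τ) ↔
      ∃ (L : Type u) (_ : Field L) (φ : K →+* L) (R : Subring L),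
        EtaleOpen.IsElementaryExtension φ ∧ R ≠ ⊤ ∧ HenselianLocalRing R ∧ IsFractionRing R L ∧
          EtaleOpen.InducesEtaleOpen (EtaleOpen.adicTopology R) := by
  constructor
  · rintro ⟨τ, h1, h2, h3⟩
    exact EtaleOpen.exists_henselian_of_inducesEtaleOpen τ h1 h2 h3
  · rintro ⟨L, _, φ, R, hφ, hR, _, _, h⟩
    exact EtaleOpen.exists_locallyBdd_of_henselian hφ R hR h
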